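/- **Setting.** Let $S$ and $A$ be Polish spaces with Borel $\sigma$-algebras $\mathcal F$ and $\mathcal A$, and let $\lambda$ and $\tau$ be $\sigma$-finite measures on $S$ and $A$. A *hidden Markov model (HMM) with densities* consists of these data, a transition probability $M$ from $S$ to $S\times A$, and a measurable function $m:S\times S\times A\to[0,\infty)$ with $$M(s,F\times B)=\int_F\int_B m(s,t,a)\,\tau(da)\,\lambda(dt)\qquad(s\in S,\ F\in\mathcal F,\ B\in\mathcal A).$$ Its Markov kernel is $P(s,F)=M(s,F\times A)$. For finite measures $\mu,\nu$ put $\delta_{TV}(\mu,\nu)=\sup_F(\mu(F)-\nu(F))+\sup_F(\nu(F)-\mu(F))$, with suprema over measurable $F$. Let $\mathcal Q_\lambda$ be the set of finite $\lambda$-absolutely continuous measures on $S$ with the metric $\delta_{TV}$, let $K\subset\mathcal Q_\lambda$ be the subset of probability measures, and let $\mathcal E$ be the Borel $\sigma$-algebra of $(K,\delta_{TV})$. For $x\in \mathcal Q_\lambda$ and $a\in A$ put $xM_a(F)=\int_F\int_S m(s,t,a)\,x(ds)\,\lambda(dt)$ and $\|xM_a\|=xM_a(S)$. The HMM is *regular*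 if $xM_a\in\mathcal Q_\lambda$ for all $x\in\mathcal Q_\lambda$, $a\in A$, and the map $(x,a)\mapsto xM_a$ from $\mathcal Q_\lambda\times A$ to $\mathcal Q_\lambda$ is continuous. The *filter kernel* $\mathbf P$ of a regular HMM is the transition probability on $(K,\mathcal E)$ given by $$\mathbf P(x,E)=\int_{\{a:\|xM_a\|>0\}}1_E\!\left(\frac{xM_a}{\|xM_a\|}\right)\|xM_a\|\,\tau(da).$$ The HMM is *strongly ergodic* with limit measure $\pi$ if $\pi$ is a probability measure on $S$ and $\delta_{TV}(P^n(s,\cdot),\pi)\to0$ for every $s\in S$; it is moreover *uniformly ergodic* if $\sup_{s\in S}\delta_{TV}(P^n(s,\cdot),\pi)\to0$. The *barycenter* of a probability $\mu$ on $(K,\mathcal E)$ is the measure $F\mapsto\int_K x(F)\,\mu(dx)$ on $S$, and a *coupling* of two probabilities on $(K,\mathcal E)$ is a probability on $(K\times K,\mathcal E\otimes\mathcal E)$ with these marginals. *Condition E* says: for every $\rho>0$ there are an integer $N\ge0$ and a number $\alpha>0$ such that for any two probabilities $\mu,\nu$ on $(K,\mathcal E)$ with barycenter $\pi$ there is a coupling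 $\tilde\mu_N$ of $\mu\mathbf P^N$ and $\nu\mathbf P^N$ with $$\tilde\mu_N\big(\{(x,y)\in K\times K:\delta_{TV}(x,y)<\rho\}\big)\ge\alpha.$$ A transition probability $Q$ on a metric space $X$ with its Borel $\sigma$-algebra is *weakly contracting* if, for all $x,y\in X$, $$\lim_{n\to\infty}\ \sup_u\left(\int u\,dQ^n(x,\cdot)-\int u\,dQ^n(y,\cdot)\right)=0,$$ where $u$ ranges over the bounded functions $X\to\mathbb R$ that are Lipschitz with constant $1$. It is *weakly ergodic* if it is weakly contracting and there is a probability measure $\nu$ on $X$ with $\int u\,dQ^n(x,\cdot)\to\int u\,d\nu$ for all bounded continuous $u:X\to\mathbb R$ and all $x\in X$. **Theorem.** Take a regular HMM with densities that is strongly ergodic with limit measure $\pi$ and satisfies Condition E, and let $\mathbf P$ be its filter kernel on $(K,\mathcal E)$. Then $\mathbf P$ is weakly contracting. If, moreover, at least one of the following holds: 1. there is a probability measure on $(K,\mathcal E)$ that is invariant under $\mathbf P$; 2. there is $x_0\in K$ such that $\{\mathbf P^n(x_0,\cdot):n=1,2,\dots\}$ is tight (for the topology of $\delta_{TV}$ on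 $K$); 3. the HMM is uniformly ergodic; then $\mathbf P$ is weakly ergodic. -/

import Mathlib

open MeasureTheory ProbabilityTheory Filter Topology
open scoped ENNReal NNReal

namespace HMMFilter

noncomputable section

/-! ### Total variation distance -/

/-- `sup_F (μ F - ν F) + sup_F (ν F - μ F)`, the suprema over all measurable sets. It is meant for
finite measures; for two probability measures it lies between `0` and `2`. -/
def tvDist {X : Type*} [MeasurableSpace X] (μ ν : Measure X) : ℝ :=
  (⨆ F : {F : Set X // MeasurableSet F}, (μ.real F.1 - ν.real F.1)) +
    ⨆ F : {F : Set X // MeasurableSet F}, (ν.real F.1 - μ.real F.1)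

section tv

variable {X : Type*} [MeasurableSpace X] (μ ν ρ : Measure X)

instance : Nonempty {F : Set X // MeasurableSet F} := ⟨⟨∅, MeasurableSet.empty⟩⟩

lemma bddAbove_real_sub [IsFiniteMeasure μ] :
    BddAbove (Set.range fun F : {F : Set X // MeasurableSet F} => μ.real F.1 - ν.real F.1) := by
  refine ⟨μ.real Set.univ, ?_⟩
  rintro _ ⟨F, rfl⟩
  have h1 : μ.real F.1 ≤ μ.real Set.univ := measureReal_mono (Set.subset_univ _)
  have h2 : 0 ≤ ν.real F.1 := measureReal_nonneg
  simp only
  linarith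

lemma real_sub_le_iSup [IsFiniteMeasure μ] {F : Set X} (hF : MeasurableSet F) :
    μ.real F - ν.real F ≤
      ⨆ F : {F : Set X // MeasurableSet F}, (μ.real F.1 - ν.real F.1) :=
  le_ciSup (bddAbove_real_sub μ ν) ⟨F, hF⟩

lemma iSup_real_sub_nonneg [IsFiniteMeasure μ] :
    0 ≤ ⨆ F : {F : Set X // MeasurableSet F}, (μ.real F.1 - ν.real F.1) := by
  simpa using real_sub_le_iSup μ ν MeasurableSet.empty

lemma tvDist_self : tvDist μ μ = 0 := by simp [tvDist]

lemma tvDist_comm : tvDist μ ν = tvDist ν μ := by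
  unfold tvDist; rw [add_comm]

lemma iSup_real_sub_triangle [IsFiniteMeasure μ] [IsFiniteMeasure ν] :
    (⨆ F : {F : Set X // MeasurableSet F}, (μ.real F.1 - ρ.real F.1)) ≤
      (⨆ F : {F : Set X // MeasurableSet F}, (μ.real F.1 - ν.real F.1)) +
        ⨆ F : {F : Set X // MeasurableSet F}, (ν.real F.1 - ρ.real F.1) := by
  refine ciSup_le fun F => ?_
  have h1 := real_sub_le_iSup μ ν F.2
  have h2 := real_sub_le_iSup ν ρ F.2
  linarith

lemma tvDist_triangle [IsFiniteMeasure μ] [IsFiniteMeasure ν] [IsFiniteMeasure ρ] :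
    tvDist μ ρ ≤ tvDist μ ν + tvDist ν ρ := by
  have h1 := iSup_real_sub_triangle μ ν ρ
  have h2 := iSup_real_sub_triangle ρ ν μ
  unfold tvDist
  linarith

lemma abs_real_sub_le_tvDist [IsFiniteMeasure μ] [IsFiniteMeasure ν] {F : Set X}
    (hF : MeasurableSet F) : |μ.real F - ν.real F| ≤ tvDist μ ν := by
  have h1 := real_sub_le_iSup μ ν hF
  have h2 := real_sub_le_iSup ν μ hF
  have h3 := iSup_real_sub_nonneg μ ν
  have h4 := iSup_real_sub_nonneg ν μ
  unfold tvDist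
  rw [abs_le]
  constructor <;> linarith

lemma eq_of_tvDist_eq_zero [IsFiniteMeasure μ] [IsFiniteMeasure ν] (h : tvDist μ ν = 0) :
    μ = ν := by
  refine Measure.ext fun F hF => ?_
  have h1 := abs_real_sub_le_tvDist μ ν hF
  rw [h] at h1
  have h2 : μ.real F = ν.real F := by
    have := abs_nonpos_iff.1 h1
    linarith
  exact (measureReal_eq_measureReal_iff).1 h2

lemma tvDist_le_of_forall {C : ℝ}
    (h : ∀ F, MeasurableSet F → |μ.real F - ν.real F| ≤ C) : tvDist μ ν ≤ C + C := by
  unfold tvDist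
  refine add_le_add (ciSup_le fun F => ?_) (ciSup_le fun F => ?_)
  · exact (le_abs_self _).trans (h F.1 F.2)
  · have := (neg_abs_le (μ.real F.1 - ν.real F.1))
    have := h F.1 F.2
    linarith

end tv

/-! ### Absolutely continuous finite measures and probabilities, with the total variation metric -/

section spaces

variable {S : Type*} [MeasurableSpace S] (lam : Measure S)

/-- The finite measures that are absolutely continuous with respect to `lam`. -/
structure AcFinite where
  /-- The underlying measure. -/
  toMeasure : Measure S
  isFiniteMeasure : IsFiniteMeasure toMeasure
  absolutelyContinuous : toMeasure ≪ lam

instance (x : AcFinite lam) : IsFiniteMeasure x.toMeasure := x.isFiniteMeasure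

variable {lam} in
lemma AcFinite.eq_of_toMeasure_eq {x y : AcFinite lam} (h : x.toMeasure = y.toMeasure) :
    x = y := by
  cases x; cases y; cases h; rfl

/-- The topology of `AcFinite lam` is the one of the total variation metric. -/
instance : MetricSpace (AcFinite lam) where
  dist x y := tvDist x.toMeasure y.toMeasure
  dist_self x := tvDist_self _
  dist_comm x y := tvDist_comm _ _
  dist_triangle x y z := tvDist_triangle _ _ _
  eq_of_dist_eq_zero h := AcFinite.eq_of_toMeasure_eq (eq_of_tvDist_eq_zero _ _ h)

lemma AcFinite.dist_def (x y : AcFinite lam) : dist x y = tvDist x.toMeasure y.toMeasure := rfl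

/-- The probability measures that are absolutely continuous with respect to `lam`. -/
structure AcProb where
  /-- The underlying measure. -/
  toMeasure : Measure S
  isProbabilityMeasure : IsProbabilityMeasure toMeasure
  absolutelyContinuous : toMeasure ≪ lam

instance (x : AcProb lam) : IsProbabilityMeasure x.toMeasure := x.isProbabilityMeasure

variable {lam} in
/-- A probability as a finite measure. -/
def AcProb.toAcFinite (x : AcProb lam) : AcFinite lam where
  toMeasure := x.toMeasure
  isFiniteMeasure := inferInstance
  absolutelyContinuous := x.absolutelyContinuous

lemma AcProb.toAcFinite_injective : Function.Injective (AcProb.toAcFinite (lam := lam)) := by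
  rintro ⟨x, _, _⟩ ⟨y, _, _⟩ h
  cases congrArg AcFinite.toMeasure h
  rfl

/-- `AcProb lam` carries the total variation metric. -/
instance : MetricSpace (AcProb lam) :=
  MetricSpace.induced AcProb.toAcFinite (AcProb.toAcFinite_injective lam) inferInstance

/-- `AcProb lam` carries the Borel sigma-algebra of the total variation metric. -/
instance : MeasurableSpace (AcProb lam) := borel _

instance : BorelSpace (AcProb lam) := ⟨rfl⟩

lemma AcProb.dist_def (x y : AcProb lam) : dist x y = tvDist x.toMeasure y.toMeasure := rfl

lemma continuous_toAcFinite : Continuous (AcProb.toAcFinite (lam := lam)) :=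
  continuous_induced_dom

lemma continuous_real_apply {F : Set S} (hF : MeasurableSet F) :
    Continuous fun x : AcFinite lam => x.toMeasure.real F := by
  refine LipschitzWith.continuous (K := 1) (LipschitzWith.of_dist_le_mul fun x y => ?_)
  rw [Real.dist_eq, AcFinite.dist_def]
  simpa using abs_real_sub_le_tvDist _ _ hF

lemma continuous_apply {F : Set S} (hF : MeasurableSet F) :
    Continuous fun x : AcFinite lam => x.toMeasure F := by
  have h : (fun x : AcFinite lam => x.toMeasure F)
      = fun x : AcFinite lam => ENNReal.ofReal (x.toMeasure.real F) := by
    funext x; exact (ofReal_measureReal).symm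
  rw [h]
  exact ENNReal.continuous_ofReal.comp (continuous_real_apply lam hF)

lemma measurable_toMeasure : Measurable (AcProb.toMeasure (lam := lam)) :=
  Measure.measurable_of_measurable_coe _ fun _ hF =>
    ((continuous_apply lam hF).comp (continuous_toAcFinite lam)).measurable

variable {lam} in
/-- The normalization `x / ‖x‖` of a non-zero finite measure. -/
def AcFinite.normalize (x : AcFinite lam) (hx : x.toMeasure Set.univ ≠ 0) : AcProb lam where
  toMeasure := (x.toMeasure Set.univ)⁻¹ • x.toMeasure
  isProbabilityMeasure := ⟨by
    rw [Measure.smul_apply, smul_eq_mul, ENNReal.inv_mul_cancel hx (measure_ne_top _ _)]⟩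
  absolutelyContinuous := x.absolutelyContinuous.smul_left _

lemma AcFinite.normalize_toMeasure (x : AcFinite lam) (hx : x.toMeasure Set.univ ≠ 0) :
    (x.normalize hx).toMeasure = (x.toMeasure Set.univ)⁻¹ • x.toMeasure := rfl

lemma dist_normalize_le (x y : AcFinite lam) (hx : x.toMeasure Set.univ ≠ 0)
    (hy : y.toMeasure Set.univ ≠ 0) :
    dist (x.normalize hx) (y.normalize hy) ≤ 4 * dist x y / x.toMeasure.real Set.univ := by
  have hp : 0 < x.toMeasure.real Set.univ :=
    ENNReal.toReal_pos hx (measure_ne_top _ _)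
  have hq : 0 < y.toMeasure.real Set.univ :=
    ENNReal.toReal_pos hy (measure_ne_top _ _)
  have key : dist (x.normalize hx) (y.normalize hy) ≤
      2 * dist x y / x.toMeasure.real Set.univ + 2 * dist x y / x.toMeasure.real Set.univ := by
    rw [AcProb.dist_def]
    refine tvDist_le_of_forall _ _ fun F hF => ?_
    have e1 : (x.normalize hx).toMeasure.real F
        = x.toMeasure.real F / x.toMeasure.real Set.univ := by
      rw [AcFinite.normalize_toMeasure, measureReal_ennreal_smul_apply, ENNReal.toReal_inv,
        div_eq_inv_mul]; rfl
    have e2 : (y.normalize hy).toMeasure.real F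
        = y.toMeasure.real F / y.toMeasure.real Set.univ := by
      rw [AcFinite.normalize_toMeasure, measureReal_ennreal_smul_apply, ENNReal.toReal_inv,
        div_eq_inv_mul]; rfl
    rw [e1, e2]
    have h1 : |x.toMeasure.real F - y.toMeasure.real F| ≤ dist x y :=
      abs_real_sub_le_tvDist _ _ hF
    have h2 : |x.toMeasure.real Set.univ - y.toMeasure.real Set.univ| ≤ dist x y :=
      abs_real_sub_le_tvDist _ _ MeasurableSet.univ
    have h3 : y.toMeasure.real F ≤ y.toMeasure.real Set.univ :=
      measureReal_mono (Set.subset_univ _)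
    have h4 : 0 ≤ y.toMeasure.real F := measureReal_nonneg
    generalize x.toMeasure.real Set.univ = p at *
    generalize y.toMeasure.real Set.univ = q at *
    generalize x.toMeasure.real F = u at *
    generalize y.toMeasure.real F = v at *
    generalize dist x y = d at *
    have e : u / p - v / q = ((u - v) + (v / q) * (q - p)) / p := by
      field_simp
      ring
    have hvq : |v / q| ≤ 1 := by
      rw [abs_of_nonneg (by positivity)]
      exact (div_le_one hq).2 h3
    rw [e, abs_div, abs_of_pos hp]
    gcongr
    calc |u - v + v / q * (q - p)| ≤ |u - v| + |v / q| * |q - p| := by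
          rw [← abs_mul]; exact abs_add_le _ _
      _ ≤ d + 1 * d := by
          gcongr
          rw [abs_sub_comm]; exact h2
      _ = 2 * d := by ring
  calc _ ≤ _ := key
    _ = _ := by ring

lemma continuous_normalize :
    Continuous fun x : {x : AcFinite lam // x.toMeasure Set.univ ≠ 0} => x.1.normalize x.2 := by
  rw [Metric.continuous_iff']
  intro x ε hε
  have h : Tendsto (fun y : {x : AcFinite lam // x.toMeasure Set.univ ≠ 0} =>
      4 * dist x.1 y.1 / x.1.toMeasure.real Set.univ) (𝓝 x) (𝓝 0) := by
    have hc : Continuous (fun y : {x : AcFinite lam // x.toMeasure Set.univ ≠ 0} =>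
      4 * dist x.1 y.1 / x.1.toMeasure.real Set.univ) := by fun_prop
    simpa using hc.tendsto x
  filter_upwards [h.eventually (gt_mem_nhds hε)] with y hy
  rw [dist_comm]
  exact (dist_normalize_le lam x.1 y.1 x.2 y.2).trans_lt hy

/-- The barycenter `F ↦ ∫ x F dμ(x)` of a measure on the set of absolutely continuous
probabilities. -/
def barycenter (μ : Measure (AcProb lam)) : Measure S := μ.bind AcProb.toMeasure

lemma barycenter_apply (μ : Measure (AcProb lam)) {F : Set S} (hF : MeasurableSet F) :
    barycenter lam μ F = ∫⁻ x, x.toMeasure F ∂μ :=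
  Measure.bind_apply hF (measurable_toMeasure lam).aemeasurable

end spaces

/-! ### Couplings and ergodicity notions for transition probability functions -/

/-- `γ` is a coupling of `μ` and `ν`: a probability on the product with these marginals. -/
structure IsCoupling {X Y : Type*} [MeasurableSpace X] [MeasurableSpace Y]
    (γ : Measure (X × Y)) (μ : Measure X) (ν : Measure Y) : Prop where
  isProbabilityMeasure : IsProbabilityMeasure γ
  left : ∀ F, MeasurableSet F → γ (F ×ˢ Set.univ) = μ F
  right : ∀ F, MeasurableSet F → γ (Set.univ ×ˢ F) = ν F

/-- Strong ergodicity with limit measure `π`. The power `Q ^ n` is the `n`-fold composition. -/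
structure StronglyErgodic {X : Type*} [MeasurableSpace X] (Q : Kernel X X) (π : Measure X) :
    Prop where
  isProbabilityMeasure : IsProbabilityMeasure π
  tendsto : ∀ x, Tendsto (fun n : ℕ => tvDist ((Q ^ n) x) π) atTop (𝓝 0)

/-- Uniform ergodicity with limit measure `π`. -/
structure UniformlyErgodic {X : Type*} [MeasurableSpace X] (Q : Kernel X X) (π : Measure X) :
    Prop extends StronglyErgodic Q π where
  tendsto_iSup : Tendsto (fun n : ℕ => ⨆ x, tvDist ((Q ^ n) x) π) atTop (𝓝 0)

/-- `sup {⟨u, Qⁿ(x,·)⟩ - ⟨u, Qⁿ(y,·)⟩ : u bounded, 1-Lipschitz}` tends to `0` for all `x`, `y`.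
The supremum is taken in `[0, ∞]`; it is nonnegative because `u = 0` is allowed. -/
def WeaklyContracting {X : Type*} [MetricSpace X] [MeasurableSpace X] (Q : Kernel X X) : Prop :=
  ∀ x y, Tendsto (fun n : ℕ => ⨆ u : {u : BoundedContinuousFunction X ℝ // LipschitzWith 1 u},
    ENNReal.ofReal ((∫ z, u.1 z ∂(Q ^ n) x) - ∫ z, u.1 z ∂(Q ^ n) y)) atTop (𝓝 0)

/-- Weakly contracting, and all the `Qⁿ(x,·)` converge weakly to one probability measure. -/
def WeaklyErgodic {X : Type*} [MetricSpace X] [MeasurableSpace X] (Q : Kernel X X) : Prop :=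
  WeaklyContracting Q ∧ ∃ ν : Measure X, IsProbabilityMeasure ν ∧
    ∀ (u : BoundedContinuousFunction X ℝ) (x : X),
      Tendsto (fun n : ℕ => ∫ z, u z ∂(Q ^ n) x) atTop (𝓝 (∫ z, u z ∂ν))

/-! ### Hidden Markov models -/

/-- A hidden Markov model: a transition probability function from `S` to `S × A`. -/
structure HMM (S A : Type*) [MeasurableSpace S] [MeasurableSpace A] where
  /-- The HMM-kernel. -/
  M : Kernel S (S × A)
  isMarkovKernel : IsMarkovKernel M

/-- The Markov kernel `P(s, F) = M(s, F × A)` of the hidden chain. -/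
def HMM.markovKernel {S A : Type*} [MeasurableSpace S] [MeasurableSpace A] (H : HMM S A) :
    Kernel S S := H.M.fst

/-- A hidden Markov model with densities, `M(s, F × B) = ∫_F ∫_B m(s,t,a) τ(da) λ(dt)`. -/
structure DensityHMM (S A : Type*) [MeasurableSpace S] [MeasurableSpace A] extends HMM S A where
  /-- The base measure on the state space. -/
  lam : Measure S
  /-- The base measure on the observation space. -/
  tau : Measure A
  sigmaFinite_lam : SigmaFinite lam
  sigmaFinite_tau : SigmaFinite tau
  /-- The probability density kernel. -/
  m : S → S → A → ℝ≥0
  measurable_m : Measurable fun q : S × S × A => m q.1 q.2.1 q.2.2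
  M_apply : ∀ (s : S) (F : Set S) (B : Set A), MeasurableSet F → MeasurableSet B →
    M s (F ×ˢ B) = ∫⁻ t in F, ∫⁻ a in B, (m s t a : ℝ≥0∞) ∂tau ∂lam

namespace DensityHMM

variable {S A : Type*} [MeasurableSpace S] [MeasurableSpace A] (H : DensityHMM S A)

instance : IsMarkovKernel H.M := H.isMarkovKernel
instance : SigmaFinite H.lam := H.sigmaFinite_lam
instance : SigmaFinite H.tau := H.sigmaFinite_tau

/-- The measure `x M_a`, that is `F ↦ ∫_F ∫ m(s,t,a) x(ds) λ(dt)`. -/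
@[irreducible] def op (x : Measure S) (a : A) : Measure S :=
  H.lam.withDensity fun t => ∫⁻ s, (H.m s t a : ℝ≥0∞) ∂x

lemma op_apply (x : Measure S) (a : A) {F : Set S} (hF : MeasurableSet F) :
    H.op x a F = ∫⁻ t in F, ∫⁻ s, (H.m s t a : ℝ≥0∞) ∂x ∂H.lam := by
  rw [op, withDensity_apply _ hF]

lemma op_absolutelyContinuous (x : Measure S) (a : A) : H.op x a ≪ H.lam :=
  by rw [op]; exact withDensity_absolutelyContinuous _ _

lemma lintegral_op_univ (x : Measure S) [IsProbabilityMeasure x] :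
    ∫⁻ a, H.op x a Set.univ ∂H.tau = 1 := by
  have hm : Measurable fun q : S × S × A => (H.m q.1 q.2.1 q.2.2 : ℝ≥0∞) :=
    H.measurable_m.coe_nnreal_ennreal
  have h1 : ∀ a, H.op x a Set.univ = ∫⁻ s, ∫⁻ t, (H.m s t a : ℝ≥0∞) ∂H.lam ∂x := by
    intro a
    rw [op, withDensity_apply _ MeasurableSet.univ, Measure.restrict_univ]
    refine lintegral_lintegral_swap (Measurable.aemeasurable ?_)
    exact hm.comp (by fun_prop : Measurable fun q : S × S => (q.2, q.1, a))
  simp_rw [h1]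
  rw [lintegral_lintegral_swap]
  · have h2 : ∀ s, ∫⁻ a, ∫⁻ t, (H.m s t a : ℝ≥0∞) ∂H.lam ∂H.tau = 1 := by
      intro s
      rw [lintegral_lintegral_swap]
      · have := H.M_apply s Set.univ Set.univ MeasurableSet.univ MeasurableSet.univ
        rw [Set.univ_prod_univ, measure_univ] at this
        simpa using this.symm
      · exact (hm.comp (by fun_prop : Measurable fun q : A × S => (s, q.2, q.1))).aemeasurable
    simp [h2]
  · refine Measurable.aemeasurable ?_
    have : Measurable fun q : (A × S) × S => (H.m q.1.2 q.2 q.1.1 : ℝ≥0∞) :=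
      hm.comp (by fun_prop : Measurable fun q : (A × S) × S => (q.1.2, q.2, q.1.1))
    exact this.lintegral_prod_right'

/-- The map `(x, a) ↦ x M_a` from `Q_λ × A` to `Q_λ`, where `Q_λ` is the set of finite,
`λ`-absolutely continuous measures, given that the measures `x M_a` are finite. -/
def opAcFinite (hfin : ∀ (x : AcFinite H.lam) (a : A), IsFiniteMeasure (H.op x.toMeasure a))
    (q : AcFinite H.lam × A) : AcFinite H.lam where
  toMeasure := H.op q.1.toMeasure q.2
  isFiniteMeasure := hfin q.1 q.2
  absolutelyContinuous := H.op_absolutelyContinuous _ _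

/-- Regularity: each `M_a` maps `Q_λ` (with the total variation topology) into itself, and
`(x, a) ↦ x M_a` is continuous from `Q_λ × A` to `Q_λ`. -/
structure Regular [TopologicalSpace A] : Prop where
  isFiniteMeasure_op : ∀ (x : AcFinite H.lam) (a : A), IsFiniteMeasure (H.op x.toMeasure a)
  continuous_op : Continuous (H.opAcFinite isFiniteMeasure_op)

variable {H} [TopologicalSpace A]

/-- The map `(x, a) ↦ x M_a` on `K × A`, where `K` is the set of `λ`-absolutely continuous
probabilities. -/
def Regular.opAc (hH : H.Regular) (q : AcProb H.lam × A) : AcFinite H.lam :=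
  H.opAcFinite hH.isFiniteMeasure_op (q.1.toAcFinite, q.2)

lemma Regular.continuous_opAc (hH : H.Regular) : Continuous hH.opAc :=
  hH.continuous_op.comp
    (((continuous_toAcFinite H.lam).comp continuous_fst).prodMk continuous_snd)

lemma Regular.continuous_mass (hH : H.Regular) :
    Continuous fun q : AcProb H.lam × A => H.op q.1.toMeasure q.2 Set.univ :=
  (continuous_apply H.lam MeasurableSet.univ).comp hH.continuous_opAc

open Classical in
/-- The filter map: `h(x, a) = x M_a / ‖x M_a‖` if `‖x M_a‖ > 0`, and `h(x, a) = x` otherwise. -/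
def Regular.filterMap (hH : H.Regular) (q : AcProb H.lam × A) : AcProb H.lam :=
  if h : (hH.opAc q).toMeasure Set.univ ≠ 0 then (hH.opAc q).normalize h else q.1

variable [PolishSpace A] [BorelSpace A]

lemma Regular.measurable_mass (hH : H.Regular) :
    Measurable fun q : AcProb H.lam × A => H.op q.1.toMeasure q.2 Set.univ :=
  hH.continuous_mass.measurable

lemma Regular.measurable_filterMap (hH : H.Regular) : Measurable hH.filterMap := by
  have hs : MeasurableSet {q | (hH.opAc q).toMeasure Set.univ ≠ 0} :=
    (hH.measurable_mass (measurableSet_singleton 0)).compl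
  refine measurable_of_restrict_of_restrict_compl hs ?_ ?_
  · have h : Continuous fun q : {q | (hH.opAc q).toMeasure Set.univ ≠ 0} =>
        (hH.opAc q.1).normalize q.2 :=
      (continuous_normalize H.lam).comp
        (Continuous.subtype_mk (hH.continuous_opAc.comp continuous_subtype_val) fun q => q.2)
    have e : Set.domRestrict {q | (hH.opAc q).toMeasure Set.univ ≠ 0} hH.filterMap =
        fun q => (hH.opAc q.1).normalize q.2 := by
      funext q
      exact dif_pos q.2
    rw [e]
    exact h.measurable
  · have e : Set.domRestrict {q | (hH.opAc q).toMeasure Set.univ ≠ 0}ᶜ hH.filterMap =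
        fun q => q.1.1 := by
      funext q
      exact dif_neg q.2
    rw [e]
    exact measurable_fst.comp measurable_subtype_coe

/-- The law of the filter map `h(x, ·)` when the observation has density `a ↦ ‖x M_a‖` with respect
to `τ`. -/
def Regular.filterLaw (hH : H.Regular) (x : AcProb H.lam) : Measure (AcProb H.lam) :=
  (H.tau.withDensity fun a => H.op x.toMeasure a Set.univ).map fun a => hH.filterMap (x, a)

lemma Regular.filterLaw_apply_indicator (hH : H.Regular) (x : AcProb H.lam)
    {E : Set (AcProb H.lam)} (hE : MeasurableSet E) :
    hH.filterLaw x E = ∫⁻ a, (hH.filterMap ⁻¹' E).indicator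
      (fun q : AcProb H.lam × A => H.op q.1.toMeasure q.2 Set.univ) (x, a) ∂H.tau := by
  have hF : Measurable fun a => hH.filterMap (x, a) :=
    hH.measurable_filterMap.comp measurable_prodMk_left
  rw [Regular.filterLaw, Measure.map_apply hF hE, withDensity_apply _ (hF hE),
    ← lintegral_indicator (hF hE)]
  rfl

/-- The filter kernel. -/
def Regular.filterKernel (hH : H.Regular) : Kernel (AcProb H.lam) (AcProb H.lam) where
  toFun := hH.filterLaw
  measurable' := by
    refine Measure.measurable_of_measurable_coe _ fun E hE => ?_
    simp_rw [hH.filterLaw_apply_indicator _ hE]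
    exact (hH.measurable_mass.indicator (hH.measurable_filterMap hE)).lintegral_prod_right'

lemma Regular.filterKernel_coe (hH : H.Regular) (x : AcProb H.lam) :
    hH.filterKernel x = hH.filterLaw x := rfl

/-- `P(x, E) = ∫_{A_x⁺} 1_E(x M_a / ‖x M_a‖) ‖x M_a‖ τ(da)` with `A_x⁺ = {a : ‖x M_a‖ > 0}`. -/
lemma Regular.filterKernel_apply (hH : H.Regular) (x : AcProb H.lam) {E : Set (AcProb H.lam)}
    (hE : MeasurableSet E) :
    hH.filterKernel x E = ∫⁻ a in {a | 0 < H.op x.toMeasure a Set.univ},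
      E.indicator 1 (hH.filterMap (x, a)) * H.op x.toMeasure a Set.univ ∂H.tau := by
  have hg : Measurable fun a => H.op x.toMeasure a Set.univ :=
    hH.measurable_mass.comp measurable_prodMk_left
  rw [hH.filterKernel_coe, hH.filterLaw_apply_indicator x hE,
    ← lintegral_indicator (measurableSet_lt measurable_const hg)]
  refine lintegral_congr fun a => ?_
  by_cases h1 : hH.filterMap (x, a) ∈ E
  · rw [Set.indicator_of_mem (show (x, a) ∈ hH.filterMap ⁻¹' E from h1)]
    by_cases h2 : 0 < H.op x.toMeasure a Set.univ
    · rw [Set.indicator_of_mem (show a ∈ {a | 0 < H.op x.toMeasure a Set.univ} from h2),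
        Set.indicator_of_mem h1, Pi.one_apply, one_mul]
    · rw [Set.indicator_of_notMem (show a ∉ {a | 0 < H.op x.toMeasure a Set.univ} from h2)]
      exact le_antisymm (not_lt.1 h2) zero_le
  · rw [Set.indicator_of_notMem (show (x, a) ∉ hH.filterMap ⁻¹' E from h1)]
    simp [Set.indicator, h1]

instance (hH : H.Regular) : IsMarkovKernel hH.filterKernel where
  isProbabilityMeasure x := ⟨by
    have hF : Measurable fun a => hH.filterMap (x, a) :=
      hH.measurable_filterMap.comp measurable_prodMk_left
    rw [hH.filterKernel_coe, Regular.filterLaw, Measure.map_apply hF MeasurableSet.univ,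
      Set.preimage_univ, withDensity_apply _ MeasurableSet.univ, Measure.restrict_univ]
    exact H.lintegral_op_univ x.toMeasure⟩

/-- Condition E with respect to `π`: for every `ρ > 0` there are an integer `N` and a number
`α > 0` such that for any two probabilities `μ`, `ν` on `K` with barycenter `π`, the measures
`μ P^N` and `ν P^N` have a coupling that gives mass at least `α` to
`{(z, z') : δ_TV(z, z') < ρ}`. -/
def Regular.ConditionE (hH : H.Regular) (π : Measure S) : Prop :=
  ∀ ρ : ℝ, 0 < ρ → ∃ (N : ℕ) (α : ℝ), 0 < α ∧
    ∀ μ ν : Measure (AcProb H.lam), IsProbabilityMeasure μ → IsProbabilityMeasure ν →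
      barycenter H.lam μ = π → barycenter H.lam ν = π →
        ∃ γ : Measure (AcProb H.lam × AcProb H.lam),
          IsCoupling γ (μ.bind ⇑(hH.filterKernel ^ N)) (ν.bind ⇑(hH.filterKernel ^ N)) ∧
            ENNReal.ofReal α ≤ γ {z | dist z.1 z.2 < ρ}

end DensityHMM

end

end HMMFilter

/-!
The argument compares the laws of the filter started from two initial laws by testing against a
class of functions `u` on the space `K` of absolutely continuous probabilities which is stable under
the filter kernel `𝐏`. Extend `u` to the cone of finite measures as a function `w` homogeneous of
degree one (`coneExt`), and require `|w(r + p) - w(r)| ≤ ‖p‖` (`IsConeLipschitz`). On such extensions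
`𝐏` acts as `w ↦ ∫ w(· M_a) τ(da)`, the normalizations having cancelled, so the class is stable
(`Regular.isConeLipschitz_integral_pow`). Its members are `1`-Lipschitz and bounded by `1`, and it
contains all `1`-Lipschitz functions up to an additive constant and a factor `4`. In particular the
powers of `𝐏` are equicontinuous.

A law on `K` can be moved to a law with prescribed barycenter at a cost, uniform over the class, of
at most the total variation distance of the barycenters (`exists_barycenter_eq`). The barycenter
evolves by the hidden Markov kernel, so `𝐏ᵐ(z, ·)` is close to a law with barycenter `π` once
`‖z Pᵐ - π‖` is small.

Let `d` be the limit, as `n → ∞`, of the largest difference between `μ𝐏ⁿ` and `ν𝐏ⁿ` over all `μ`,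
`ν` with barycenter `π`. Couple `μ𝐏ᴺ` and `ν𝐏ᴺ` by Condition E. Pairs at distance less than `ρ`,
of mass at least `α`, stay `ρ`-close by equicontinuity. For all other pairs wait `m` steps until both
barycenters are close to `π`; from then on they contribute at most about `d`. The error made by
waiting is controlled by the average of `‖z Pᵐ - π‖` over the marginals, hence by
`∫ ‖Pᵐ(s, ·) - π‖ π(ds)`, since the marginals have barycenter `π`; this is independent of `μ`, `ν`
and tends to `0`. So `d ≤ αρ + (1 - α)d`, that is `d ≤ ρ`, for every `ρ > 0`
(`Regular.GapLE.step`, `Regular.exists_gapLE`), and weak contraction follows.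

For weak ergodicity it is enough that one orbit converges against bounded Lipschitz functions. Given
an invariant law this is dominated convergence. Along a tight orbit, equicontinuity makes the merging
uniform on compact sets, so integrals of test functions are Cauchy and Prokhorov's theorem provides
the limit. Under uniform ergodicity the merging is uniform in the starting points, so the orbit is
Cauchy uniformly over test functions; as `K` is complete and separable, being bi-Lipschitz
equivalent to a closed subset of `L¹(λ)`, such a sequence is tight
(`isTightMeasureSet_range_of_cauchy`).
-/

namespace HMMFilter

noncomputable section

/-! ### Total variation distance: common part and contraction -/

section TotalVariation

variable {X Y : Type*} [MeasurableSpace X] [MeasurableSpace Y]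

lemma tvDist_nonneg (μ ν : Measure X) [IsFiniteMeasure μ] [IsFiniteMeasure ν] :
    0 ≤ tvDist μ ν :=
  add_nonneg (iSup_real_sub_nonneg μ ν) (iSup_real_sub_nonneg ν μ)

lemma tvDist_add_left_le (r p q : Measure X) [IsFiniteMeasure r] [IsFiniteMeasure p]
    [IsFiniteMeasure q] :
    tvDist (r + p) (r + q) ≤ p.real Set.univ + q.real Set.univ := by
  unfold tvDist
  refine add_le_add (ciSup_le fun F => ?_) (ciSup_le fun F => ?_)
  · rw [measureReal_add_apply, measureReal_add_apply]
    have h1 : p.real F.1 ≤ p.real Set.univ := measureReal_mono (Set.subset_univ _)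
    have h2 : 0 ≤ q.real F.1 := measureReal_nonneg
    linarith
  · rw [measureReal_add_apply, measureReal_add_apply]
    have h1 : q.real F.1 ≤ q.real Set.univ := measureReal_mono (Set.subset_univ _)
    have h2 : 0 ≤ p.real F.1 := measureReal_nonneg
    linarith

lemma tvDist_le_two (μ ν : Measure X) [IsProbabilityMeasure μ] [IsProbabilityMeasure ν] :
    tvDist μ ν ≤ 2 := by
  have h := tvDist_add_left_le (0 : Measure X) μ ν
  simp only [zero_add, probReal_univ] at h
  linarith

/-- Two finite measures have a common part `r` (their minimum) such that the masses of the two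
remainders add up to at most the total variation distance. -/
lemma exists_common_part (μ ν : Measure X) [IsFiniteMeasure μ] [IsFiniteMeasure ν] :
    ∃ r p q : Measure X, IsFiniteMeasure r ∧ IsFiniteMeasure p ∧ IsFiniteMeasure q ∧
      μ = r + p ∧ ν = r + q ∧ p.real Set.univ + q.real Set.univ ≤ tvDist μ ν := by
  obtain ⟨s, hs, h1, h2⟩ := hahn_decomposition μ ν
  have l1 : ν.restrict s ≤ μ.restrict s := by
    refine Measure.le_iff.2 fun F hF => ?_
    rw [Measure.restrict_apply hF, Measure.restrict_apply hF]
    exact h1 _ (hF.inter hs) Set.inter_subset_right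
  have l2 : μ.restrict sᶜ ≤ ν.restrict sᶜ := by
    refine Measure.le_iff.2 fun F hF => ?_
    rw [Measure.restrict_apply hF, Measure.restrict_apply hF]
    exact h2 _ (hF.inter hs.compl) Set.inter_subset_right
  have f1 : IsFiniteMeasure (μ.restrict s - ν.restrict s) :=
    isFiniteMeasure_of_le _ Measure.sub_le
  have f2 : IsFiniteMeasure (ν.restrict sᶜ - μ.restrict sᶜ) :=
    isFiniteMeasure_of_le _ Measure.sub_le
  have e1 : μ.restrict s - ν.restrict s + ν.restrict s = μ.restrict s :=
    Measure.sub_add_cancel_of_le l1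
  have e2 : ν.restrict sᶜ - μ.restrict sᶜ + μ.restrict sᶜ = ν.restrict sᶜ :=
    Measure.sub_add_cancel_of_le l2
  refine ⟨ν.restrict s + μ.restrict sᶜ, μ.restrict s - ν.restrict s,
    ν.restrict sᶜ - μ.restrict sᶜ, inferInstance, f1, f2, ?_, ?_, ?_⟩
  · rw [add_comm (ν.restrict s), add_assoc, add_comm (ν.restrict s), e1, add_comm,
      Measure.restrict_add_restrict_compl hs]
  · rw [add_assoc, add_comm (μ.restrict sᶜ), e2, Measure.restrict_add_restrict_compl hs]
  · have g1 : (μ.restrict s - ν.restrict s).real Set.univ = μ.real s - ν.real s := by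
      have := congrArg (fun m : Measure X => m.real Set.univ) e1
      rw [measureReal_add_apply, measureReal_restrict_apply_univ,
        measureReal_restrict_apply_univ] at this
      linarith
    have g2 : (ν.restrict sᶜ - μ.restrict sᶜ).real Set.univ = ν.real sᶜ - μ.real sᶜ := by
      have := congrArg (fun m : Measure X => m.real Set.univ) e2
      rw [measureReal_add_apply, measureReal_restrict_apply_univ,
        measureReal_restrict_apply_univ] at this
      linarith
    rw [g1, g2]
    exact add_le_add (real_sub_le_iSup μ ν hs) (real_sub_le_iSup ν μ hs.compl)

lemma bind_real_univ (μ : Measure X) (κ : Kernel X Y) [IsMarkovKernel κ] :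
    (μ.bind κ).real Set.univ = μ.real Set.univ := by
  rw [measureReal_def, Measure.bind_apply MeasurableSet.univ κ.aemeasurable]
  simp [measureReal_def]

lemma tvDist_bind_le (μ ν : Measure X) [IsFiniteMeasure μ] [IsFiniteMeasure ν] (κ : Kernel X Y)
    [IsMarkovKernel κ] : tvDist (μ.bind κ) (ν.bind κ) ≤ tvDist μ ν := by
  obtain ⟨r, p, q, _, _, _, e1, e2, h⟩ := exists_common_part μ ν
  refine le_trans ?_ h
  rw [e1, e2, Measure.comp_add, Measure.comp_add]
  refine (tvDist_add_left_le _ _ _).trans_eq ?_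
  rw [bind_real_univ, bind_real_univ]

instance isMarkovKernel_pow (κ : Kernel X X) [IsMarkovKernel κ] (n : ℕ) :
    IsMarkovKernel (κ ^ n) := by
  induction n with
  | zero => rw [pow_zero]; exact inferInstanceAs (IsMarkovKernel Kernel.id)
  | succ n ih => rw [pow_succ]; exact inferInstanceAs (IsMarkovKernel ((κ ^ n) ∘ₖ κ))

end TotalVariation

/-! ### The cone of absolutely continuous finite measures -/

section Cone

variable {S : Type*} [MeasurableSpace S] {lam : Measure S}

instance : Add (AcFinite lam) where
  add x y :=
    { toMeasure := x.toMeasure + y.toMeasure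
      isFiniteMeasure := inferInstance
      absolutelyContinuous := fun _ h => by
        simp [x.absolutelyContinuous h, y.absolutelyContinuous h] }

instance : SMul ℝ≥0 (AcFinite lam) where
  smul c x :=
    { toMeasure := c • x.toMeasure
      isFiniteMeasure := inferInstance
      absolutelyContinuous := x.absolutelyContinuous.smul_left c }

/-- The total mass of a finite measure. -/
def AcFinite.mass (x : AcFinite lam) : ℝ := x.toMeasure.real Set.univ

lemma AcFinite.add_toMeasure (x y : AcFinite lam) :
    (x + y).toMeasure = x.toMeasure + y.toMeasure := rfl

lemma AcFinite.smul_toMeasure (c : ℝ≥0) (x : AcFinite lam) :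
    (c • x).toMeasure = c • x.toMeasure := rfl

lemma AcFinite.mass_nonneg (x : AcFinite lam) : 0 ≤ x.mass := measureReal_nonneg

lemma AcFinite.mass_add (x y : AcFinite lam) : (x + y).mass = x.mass + y.mass := by
  rw [mass, add_toMeasure, measureReal_add_apply]
  rfl

lemma AcFinite.mass_smul (c : ℝ≥0) (x : AcFinite lam) : (c • x).mass = c * x.mass := by
  simp [mass, smul_toMeasure]

lemma AcFinite.mass_pos {x : AcFinite lam} (hx : x.toMeasure Set.univ ≠ 0) : 0 < x.mass :=
  ENNReal.toReal_pos hx (measure_ne_top _ _)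

lemma AcFinite.mass_eq_zero {x : AcFinite lam} (hx : ¬ x.toMeasure Set.univ ≠ 0) :
    x.mass = 0 := by
  rw [mass, measureReal_def, not_not.1 hx, ENNReal.toReal_zero]

lemma AcProb.mass_toAcFinite (z : AcProb lam) : z.toAcFinite.mass = 1 :=
  probReal_univ (μ := z.toMeasure)

lemma AcProb.eq_of_toMeasure_eq {x y : AcProb lam} (h : x.toMeasure = y.toMeasure) : x = y := by
  cases x; cases y; cases h; rfl

lemma AcProb.normalize_toAcFinite (z : AcProb lam) (h : z.toAcFinite.toMeasure Set.univ ≠ 0) :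
    z.toAcFinite.normalize h = z := by
  refine AcProb.eq_of_toMeasure_eq ?_
  rw [AcFinite.normalize_toMeasure]
  have : z.toAcFinite.toMeasure Set.univ = 1 := measure_univ (μ := z.toMeasure)
  rw [this, inv_one, one_smul]
  rfl

/-- A non-zero finite measure is its mass times its normalization. -/
lemma AcFinite.smul_normalize (x : AcFinite lam) (h : x.toMeasure Set.univ ≠ 0) :
    x.mass.toNNReal • (x.normalize h).toAcFinite = x := by
  refine AcFinite.eq_of_toMeasure_eq ?_
  change x.mass.toNNReal • ((x.toMeasure Set.univ)⁻¹ • x.toMeasure) = x.toMeasure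
  have e : ((x.mass.toNNReal : ℝ≥0) : ℝ≥0∞) = x.toMeasure Set.univ := by
    change ENNReal.ofReal _ = _
    exact ofReal_measureReal
  rw [← Measure.coe_nnreal_smul, e, smul_smul, ENNReal.mul_inv_cancel h (measure_ne_top _ _),
    one_smul]

lemma AcFinite.normalize_smul (c : ℝ≥0) (hc : c ≠ 0) (x : AcFinite lam)
    (hx : x.toMeasure Set.univ ≠ 0) (h : (c • x).toMeasure Set.univ ≠ 0) :
    (c • x).normalize h = x.normalize hx := by
  refine AcProb.eq_of_toMeasure_eq ?_
  rw [normalize_toMeasure, normalize_toMeasure, smul_toMeasure, ← Measure.coe_nnreal_smul]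
  rw [Measure.smul_apply, smul_smul, smul_eq_mul,
    ENNReal.mul_inv (Or.inl (by simpa using hc)) (Or.inl ENNReal.coe_ne_top), mul_comm, ← mul_assoc,
    ENNReal.mul_inv_cancel (by simpa using hc) ENNReal.coe_ne_top, one_mul]

open Classical in
/-- The extension of a function on probabilities to the cone of finite measures that is
homogeneous of degree one: `x ↦ ‖x‖ u(x / ‖x‖)`, with value `0` at the zero measure. -/
def coneExt (u : AcProb lam → ℝ) (x : AcFinite lam) : ℝ :=
  if h : x.toMeasure Set.univ ≠ 0 then x.mass * u (x.normalize h) else 0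

lemma coneExt_of_ne_zero (u : AcProb lam → ℝ) {x : AcFinite lam}
    (h : x.toMeasure Set.univ ≠ 0) : coneExt u x = x.mass * u (x.normalize h) := dif_pos h

lemma coneExt_of_eq_zero (u : AcProb lam → ℝ) {x : AcFinite lam}
    (h : ¬ x.toMeasure Set.univ ≠ 0) : coneExt u x = 0 := dif_neg h

lemma coneExt_toAcFinite (u : AcProb lam → ℝ) (z : AcProb lam) :
    coneExt u z.toAcFinite = u z := by
  have h : z.toAcFinite.toMeasure Set.univ ≠ 0 := by
    have : z.toAcFinite.toMeasure Set.univ = 1 := measure_univ (μ := z.toMeasure)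
    simp [this]
  rw [coneExt_of_ne_zero u h, z.mass_toAcFinite, one_mul, z.normalize_toAcFinite]

lemma coneExt_smul (u : AcProb lam → ℝ) (c : ℝ≥0) (x : AcFinite lam) :
    coneExt u (c • x) = c * coneExt u x := by
  by_cases hx : x.toMeasure Set.univ ≠ 0
  · by_cases hc : c = 0
    · rw [hc, coneExt_of_eq_zero]
      · simp
      · simp [AcFinite.smul_toMeasure]
    · have h : (c • x).toMeasure Set.univ ≠ 0 := by
        simpa [AcFinite.smul_toMeasure, hc] using hx
      rw [coneExt_of_ne_zero u h, coneExt_of_ne_zero u hx, AcFinite.normalize_smul c hc x hx h,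
        AcFinite.mass_smul, mul_assoc]
  · rw [coneExt_of_eq_zero u hx, coneExt_of_eq_zero, mul_zero]
    rw [not_not] at hx ⊢
    simp [AcFinite.smul_toMeasure, hx]

lemma AcFinite.exists_common_part (x y : AcFinite lam) :
    ∃ r p q : AcFinite lam, x = r + p ∧ y = r + q ∧ p.mass + q.mass ≤ dist x y := by
  obtain ⟨r, p, q, hr, hp, hq, e1, e2, h⟩ :=
    HMMFilter.exists_common_part x.toMeasure y.toMeasure
  have a1 : r ≪ lam := (Measure.absolutelyContinuous_of_le
    (e1 ▸ Measure.le_add_right le_rfl)).trans x.absolutelyContinuous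
  have a2 : p ≪ lam := (Measure.absolutelyContinuous_of_le
    (e1 ▸ Measure.le_add_left le_rfl)).trans x.absolutelyContinuous
  have a3 : q ≪ lam := (Measure.absolutelyContinuous_of_le
    (e2 ▸ Measure.le_add_left le_rfl)).trans y.absolutelyContinuous
  exact ⟨⟨r, hr, a1⟩, ⟨p, hp, a2⟩, ⟨q, hq, a3⟩, AcFinite.eq_of_toMeasure_eq e1,
    AcFinite.eq_of_toMeasure_eq e2, h⟩

lemma AcFinite.dist_add_left_le (r p q : AcFinite lam) :
    dist (r + p) (r + q) ≤ p.mass + q.mass :=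
  tvDist_add_left_le r.toMeasure p.toMeasure q.toMeasure

end Cone

/-! ### Test functions whose homogeneous extension is Lipschitz -/

section ConeLipschitz

variable {S : Type*} [MeasurableSpace S] {lam : Measure S}

/-- Measurable functions on the set of probabilities whose homogeneous extension `w` to the cone of
finite measures satisfies `|w(r + p) - w(r)| ≤ ‖p‖`. By the decomposition of a pair of measures into
common part and remainders, this says that `w` is `1`-Lipschitz for the total variation distance. -/
structure IsConeLipschitz (u : AcProb lam → ℝ) : Prop where
  measurable : Measurable u
  abs_sub_le : ∀ r p : AcFinite lam, |coneExt u (r + p) - coneExt u r| ≤ p.mass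

namespace IsConeLipschitz

variable {u : AcProb lam → ℝ}

lemma abs_coneExt_le (hu : IsConeLipschitz u) (x : AcFinite lam) : |coneExt u x| ≤ x.mass := by
  have h := hu.abs_sub_le ((0 : ℝ≥0) • x) x
  have e : (0 : ℝ≥0) • x + x = x := AcFinite.eq_of_toMeasure_eq (by
    simp [AcFinite.add_toMeasure, AcFinite.smul_toMeasure])
  rw [e, coneExt_smul] at h
  simpa using h

lemma abs_le_one (hu : IsConeLipschitz u) (z : AcProb lam) : |u z| ≤ 1 := by
  simpa [coneExt_toAcFinite, AcProb.mass_toAcFinite] using hu.abs_coneExt_le z.toAcFinite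

lemma abs_sub_le_dist (hu : IsConeLipschitz u) (x y : AcProb lam) : |u x - u y| ≤ dist x y := by
  obtain ⟨r, p, q, e1, e2, h⟩ := AcFinite.exists_common_part x.toAcFinite y.toAcFinite
  have h1 := hu.abs_sub_le r p
  have h2 := hu.abs_sub_le r q
  rw [← e1, coneExt_toAcFinite] at h1
  rw [← e2, coneExt_toAcFinite] at h2
  refine le_trans ?_ h
  rw [abs_le] at *
  constructor <;> linarith

lemma integrable (hu : IsConeLipschitz u) (μ : Measure (AcProb lam)) [IsFiniteMeasure μ] :
    Integrable u μ :=
  Integrable.of_bound hu.measurable.aestronglyMeasurable 1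
    (Eventually.of_forall fun z => hu.abs_le_one z)

end IsConeLipschitz

lemma dist_le_two (x y : AcProb lam) : dist x y ≤ 2 :=
  tvDist_le_two x.toMeasure y.toMeasure

/-- The normalizations of `r + p` and `r` differ by at most `2‖p‖ / ‖r + p‖`. -/
lemma mass_mul_dist_normalize_add_le (r p : AcFinite lam) (hr : r.toMeasure Set.univ ≠ 0)
    (h : (r + p).toMeasure Set.univ ≠ 0) :
    (r + p).mass * dist ((r + p).normalize h) (r.normalize hr) ≤ 2 * p.mass := by
  have hc := AcFinite.mass_pos h
  have hr' := AcFinite.mass_pos hr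
  have hp := p.mass_nonneg
  set c := (r + p).mass.toNNReal with hcd
  have hc' : (c : ℝ) = (r + p).mass := Real.coe_toNNReal _ hc.le
  have hc0 : c ≠ 0 := by
    intro h0
    rw [h0] at hc'
    simp only [NNReal.coe_zero] at hc'
    linarith
  have e1 : ((r + p).normalize h).toAcFinite = c⁻¹ • r + c⁻¹ • p := by
    refine AcFinite.eq_of_toMeasure_eq ?_
    have e := congrArg AcFinite.toMeasure ((r + p).smul_normalize h)
    rw [AcFinite.smul_toMeasure, AcFinite.add_toMeasure] at e
    rw [AcFinite.add_toMeasure, AcFinite.smul_toMeasure, AcFinite.smul_toMeasure, ← smul_add,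
      ← e, smul_smul, ← hcd, inv_mul_cancel₀ hc0, one_smul]
  -- the remainder of the normalization of `r` has mass `1 - ‖r‖ / ‖r + p‖ = ‖p‖ / ‖r + p‖`
  set d : ℝ≥0 := (p.mass / (r + p).mass).toNNReal with hd
  have hd' : (d : ℝ) = p.mass / (r + p).mass := Real.coe_toNNReal _ (by positivity)
  have hm : (r + p).mass = r.mass + p.mass := AcFinite.mass_add r p
  have e2 : (r.normalize hr).toAcFinite = c⁻¹ • r + d • (r.normalize hr).toAcFinite := by
    refine AcFinite.eq_of_toMeasure_eq ?_
    have e := congrArg AcFinite.toMeasure (r.smul_normalize hr)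
    rw [AcFinite.smul_toMeasure] at e
    rw [AcFinite.add_toMeasure, AcFinite.smul_toMeasure, AcFinite.smul_toMeasure]
    rw [← e, smul_smul, ← add_smul]
    have : c⁻¹ * r.mass.toNNReal + d = 1 := by
      rw [← NNReal.coe_inj]
      push_cast
      rw [hc', hd', Real.coe_toNNReal _ hr'.le, hm]
      rw [hm] at hc
      field_simp
    rw [this, one_smul]
  have key : dist ((r + p).normalize h).toAcFinite (r.normalize hr).toAcFinite ≤
      p.mass / (r + p).mass + p.mass / (r + p).mass := by
    rw [e1, e2]
    refine (AcFinite.dist_add_left_le _ _ _).trans_eq ?_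
    rw [AcFinite.mass_smul, AcFinite.mass_smul, AcProb.mass_toAcFinite, hd', NNReal.coe_inv, hc',
      mul_one, inv_mul_eq_div]
  calc (r + p).mass * dist ((r + p).normalize h) (r.normalize hr)
      ≤ (r + p).mass * (p.mass / (r + p).mass + p.mass / (r + p).mass) := by
        gcongr
        exact key
    _ = 2 * p.mass := by field_simp; ring

/-- A `1`-Lipschitz function becomes a test function after centering and division by `4`: the
total variation diameter of the set of probabilities is at most `2`. -/
lemma isConeLipschitz_of_lipschitz {u : AcProb lam → ℝ} (hu : LipschitzWith 1 u)
    (z₀ : AcProb lam) : IsConeLipschitz fun z => (u z - u z₀) / 4 := by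
  have hl : ∀ x y, |u x - u y| ≤ dist x y := fun x y => by
    simpa [Real.dist_eq] using hu.dist_le_mul x y
  refine ⟨(hu.continuous.measurable.sub_const _).div_const _, fun r p => ?_⟩
  set v : AcProb lam → ℝ := fun z => (u z - u z₀) / 4
  have hv1 : ∀ z, |v z| ≤ 1 / 2 := fun z => by
    have := (hl z z₀).trans (dist_le_two z z₀)
    rw [abs_div, abs_of_pos (by norm_num : (0 : ℝ) < 4)]
    linarith
  have hv2 : ∀ x y, |v x - v y| ≤ dist x y / 4 := fun x y => by
    have e : v x - v y = (u x - u y) / 4 := by simp only [v]; ring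
    rw [e, abs_div, abs_of_pos (by norm_num : (0 : ℝ) < 4)]
    have := hl x y
    linarith
  have hp := p.mass_nonneg
  by_cases hrp : (r + p).toMeasure Set.univ ≠ 0
  · rw [coneExt_of_ne_zero v hrp]
    by_cases hr : r.toMeasure Set.univ ≠ 0
    · rw [coneExt_of_ne_zero v hr]
      have e : (r + p).mass * v ((r + p).normalize hrp) - r.mass * v (r.normalize hr) =
          (r + p).mass * (v ((r + p).normalize hrp) - v (r.normalize hr))
            + p.mass * v (r.normalize hr) := by
        rw [AcFinite.mass_add]; ring
      rw [e]
      have h1 := mass_mul_dist_normalize_add_le r p hr hrp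
      have h2 := hv2 ((r + p).normalize hrp) (r.normalize hr)
      have h3 := hv1 (r.normalize hr)
      calc _ ≤ |(r + p).mass * (v ((r + p).normalize hrp) - v (r.normalize hr))|
            + |p.mass * v (r.normalize hr)| := abs_add_le _ _
        _ ≤ (r + p).mass * (dist ((r + p).normalize hrp) (r.normalize hr) / 4)
            + p.mass * (1 / 2) := by
          rw [abs_mul, abs_mul, abs_of_nonneg hp, abs_of_nonneg (r + p).mass_nonneg]
          have := (r + p).mass_nonneg
          gcongr
        _ ≤ p.mass := by linarith
    · rw [coneExt_of_eq_zero v hr, sub_zero, AcFinite.mass_add, AcFinite.mass_eq_zero hr, zero_add,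
        abs_mul, abs_of_nonneg hp]
      have := hv1 ((r + p).normalize hrp)
      nlinarith
  · have hr : ¬ r.toMeasure Set.univ ≠ 0 := by
      rw [not_not] at hrp ⊢
      rw [AcFinite.add_toMeasure, Measure.add_apply] at hrp
      exact (add_eq_zero.1 hrp).1
    rw [coneExt_of_eq_zero v hrp, coneExt_of_eq_zero v hr]
    simpa using hp

lemma integral_sub_div_four {u : AcProb lam → ℝ} (hu : LipschitzWith 1 u) (z₀ : AcProb lam)
    (κ : Measure (AcProb lam)) [IsProbabilityMeasure κ] :
    ∫ z, (u z - u z₀) / 4 ∂κ = (∫ z, u z ∂κ - u z₀) / 4 := by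
  have hi : Integrable u κ := by
    have h := (((isConeLipschitz_of_lipschitz hu z₀).integrable κ).const_mul 4).add
      (integrable_const (u z₀))
    refine h.congr (Eventually.of_forall fun z => ?_)
    simp only [Pi.add_apply]
    ring
  rw [integral_div, integral_sub hi (integrable_const _)]
  simp

end ConeLipschitz

/-! ### Normalizing random finite measures -/

section Projectivize

variable {S : Type*} [MeasurableSpace S] {lam : Measure S}

/-- The cone of finite measures carries the Borel sigma-algebra of the total variation metric. -/
instance : MeasurableSpace (AcFinite lam) := borel _

instance : BorelSpace (AcFinite lam) := ⟨rfl⟩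

open Classical in
/-- Normalization of finite measures, with value `z₀` at the zero measure. -/
def normalizeOr (z₀ : AcProb lam) (x : AcFinite lam) : AcProb lam :=
  if h : x.toMeasure Set.univ ≠ 0 then x.normalize h else z₀

lemma measurableSet_mass_ne_zero :
    MeasurableSet {x : AcFinite lam | x.toMeasure Set.univ ≠ 0} :=
  ((continuous_apply lam MeasurableSet.univ).measurable (measurableSet_singleton 0)).compl

lemma measurable_normalizeOr (z₀ : AcProb lam) : Measurable (normalizeOr z₀) := by
  refine measurable_of_restrict_of_restrict_compl measurableSet_mass_ne_zero ?_ ?_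
  · have e : Set.domRestrict {x : AcFinite lam | x.toMeasure Set.univ ≠ 0} (normalizeOr z₀) =
        fun x => x.1.normalize x.2 := by
      funext x
      exact dif_pos x.2
    rw [e]
    exact (continuous_normalize lam).measurable
  · have e : Set.domRestrict {x : AcFinite lam | x.toMeasure Set.univ ≠ 0}ᶜ (normalizeOr z₀) =
        fun _ => z₀ := by
      funext x
      exact dif_neg x.2
    rw [e]
    exact measurable_const

lemma mass_mul_normalizeOr (u : AcProb lam → ℝ) (z₀ : AcProb lam) (x : AcFinite lam) :
    x.mass * u (normalizeOr z₀ x) = coneExt u x := by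
  by_cases h : x.toMeasure Set.univ ≠ 0
  · rw [coneExt_of_ne_zero u h, normalizeOr, dif_pos h]
  · rw [coneExt_of_eq_zero u h, AcFinite.mass_eq_zero h, zero_mul]

lemma mass_mul_normalizeOr_apply (z₀ : AcProb lam) (x : AcFinite lam) (F : Set S) :
    x.toMeasure Set.univ * (normalizeOr z₀ x).toMeasure F = x.toMeasure F := by
  by_cases h : x.toMeasure Set.univ ≠ 0
  · rw [normalizeOr, dif_pos h, AcFinite.normalize_toMeasure, Measure.smul_apply, smul_eq_mul,
      ← mul_assoc, ENNReal.mul_inv_cancel h (measure_ne_top _ _), one_mul]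
  · rw [not_not] at h
    rw [h, zero_mul]
    exact (measure_mono_null (Set.subset_univ F) h).symm

lemma measurable_mass : Measurable (AcFinite.mass (lam := lam)) :=
  (continuous_real_apply lam MeasurableSet.univ).measurable

lemma measurable_coneExt {u : AcProb lam → ℝ} (hu : Measurable u) : Measurable (coneExt u) := by
  rcases isEmpty_or_nonempty (AcProb lam) with h | ⟨⟨z₀⟩⟩
  · have : coneExt u = fun _ => 0 := by
      funext x
      refine coneExt_of_eq_zero u fun hx => h.false (x.normalize hx)
    rw [this]
    exact measurable_const
  · have : coneExt u = fun x => x.mass * u (normalizeOr z₀ x) := by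
      funext x
      exact (mass_mul_normalizeOr u z₀ x).symm
    rw [this]
    exact measurable_mass.mul (hu.comp (measurable_normalizeOr z₀))

variable {Ω : Type*} [MeasurableSpace Ω]

/-- The law of the normalization of `Z` under the measure with density `‖Z‖` with respect to `κ`. -/
def normalizedLaw (z₀ : AcProb lam) (κ : Measure Ω) (Z : Ω → AcFinite lam) :
    Measure (AcProb lam) :=
  (κ.withDensity fun ω => (Z ω).toMeasure Set.univ).map fun ω => normalizeOr z₀ (Z ω)

variable {Z : Ω → AcFinite lam}

lemma measurable_apply_of_measurable (hZ : Measurable Z) {F : Set S} (hF : MeasurableSet F) :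
    Measurable fun ω => (Z ω).toMeasure F :=
  (continuous_apply lam hF).measurable.comp hZ

lemma measurable_normalizeOr_comp (z₀ : AcProb lam) (hZ : Measurable Z) :
    Measurable fun ω => normalizeOr z₀ (Z ω) :=
  (measurable_normalizeOr z₀).comp hZ

lemma integral_normalizedLaw (z₀ : AcProb lam) (κ : Measure Ω) (hZ : Measurable Z)
    {u : AcProb lam → ℝ} (hu : Measurable u) :
    ∫ z, u z ∂(normalizedLaw z₀ κ Z) = ∫ ω, coneExt u (Z ω) ∂κ := by
  rw [normalizedLaw, integral_map (measurable_normalizeOr_comp z₀ hZ).aemeasurable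
    hu.aestronglyMeasurable,
    integral_withDensity_eq_integral_toReal_smul (measurable_apply_of_measurable hZ .univ)
      (Eventually.of_forall fun ω => measure_lt_top _ _)]
  exact integral_congr_ae (Eventually.of_forall fun ω => mass_mul_normalizeOr u z₀ (Z ω))

lemma lintegral_normalizedLaw_apply (z₀ : AcProb lam) (κ : Measure Ω) (hZ : Measurable Z)
    {F : Set S} (hF : MeasurableSet F) :
    ∫⁻ z, z.toMeasure F ∂(normalizedLaw z₀ κ Z) = ∫⁻ ω, (Z ω).toMeasure F ∂κ := by
  have hm : Measurable fun z : AcProb lam => z.toMeasure F :=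
    (Measure.measurable_coe hF).comp (measurable_toMeasure lam)
  have hc : Measurable fun ω => (normalizeOr z₀ (Z ω)).toMeasure F :=
    hm.comp (measurable_normalizeOr_comp z₀ hZ)
  rw [normalizedLaw, lintegral_map hm (measurable_normalizeOr_comp z₀ hZ),
    lintegral_withDensity_eq_lintegral_mul _ (measurable_apply_of_measurable hZ .univ)
      hc]
  exact lintegral_congr fun ω => mass_mul_normalizeOr_apply z₀ (Z ω) F

lemma normalizedLaw_univ (z₀ : AcProb lam) (κ : Measure Ω) (hZ : Measurable Z) :
    normalizedLaw z₀ κ Z Set.univ = ∫⁻ ω, (Z ω).toMeasure Set.univ ∂κ := by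
  rw [normalizedLaw, Measure.map_apply (measurable_normalizeOr_comp z₀ hZ) .univ,
    Set.preimage_univ, withDensity_apply _ .univ, Measure.restrict_univ]

end Projectivize

/-! ### Changing the barycenter -/

section Barycenter

variable {S : Type*} [MeasurableSpace S] {lam : Measure S}

instance (μ : Measure (AcProb lam)) [IsProbabilityMeasure μ] :
    IsProbabilityMeasure (barycenter lam μ) := ⟨by
  rw [barycenter_apply lam μ .univ]
  simp⟩

/-- The measure with density `g ≤ 1` with respect to the probability `z`. -/
def AcProb.scale (g : S → ℝ≥0∞) (hg : ∀ s, g s ≤ 1) (z : AcProb lam) : AcFinite lam where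
  toMeasure := z.toMeasure.withDensity g
  isFiniteMeasure := isFiniteMeasure_withDensity (ne_top_of_le_ne_top ENNReal.one_ne_top
    ((lintegral_mono hg).trans_eq (by simp)))
  absolutelyContinuous := (withDensity_absolutelyContinuous _ _).trans z.absolutelyContinuous

lemma withDensity_le_of_le_one (μ : Measure S) {g : S → ℝ≥0∞} (hg : ∀ s, g s ≤ 1) :
    μ.withDensity g ≤ μ := by
  refine (withDensity_mono (Eventually.of_forall hg)).trans_eq ?_
  exact withDensity_one

lemma withDensity_real_le_of_le_one (μ : Measure S) [IsFiniteMeasure μ] {g : S → ℝ≥0∞}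
    (hg : ∀ s, g s ≤ 1) (F : Set S) : (μ.withDensity g).real F ≤ μ.real F :=
  ENNReal.toReal_mono (measure_ne_top _ _) (withDensity_le_of_le_one μ hg F)

lemma continuous_scale {g : S → ℝ≥0∞} (hg : ∀ s, g s ≤ 1) :
    Continuous (AcProb.scale (lam := lam) g hg) := by
  refine LipschitzWith.continuous (K := 1) (LipschitzWith.of_dist_le_mul fun x y => ?_)
  obtain ⟨r, p, q, hr, hp, hq, e1, e2, h⟩ := exists_common_part x.toMeasure y.toMeasure
  rw [NNReal.coe_one, one_mul]
  refine le_trans ?_ h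
  have hf : ∀ m : Measure S, IsFiniteMeasure m → IsFiniteMeasure (m.withDensity g) := fun m _ =>
    isFiniteMeasure_of_le m (withDensity_le_of_le_one m hg)
  have := hf r hr
  have := hf p hp
  have := hf q hq
  have e1' : (x.scale g hg).toMeasure = r.withDensity g + p.withDensity g := by
    rw [← withDensity_add_measure, ← e1]; rfl
  have e2' : (y.scale g hg).toMeasure = r.withDensity g + q.withDensity g := by
    rw [← withDensity_add_measure, ← e2]; rfl
  rw [AcFinite.dist_def, e1', e2']
  refine (tvDist_add_left_le _ _ _).trans (add_le_add ?_ ?_)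
  · exact withDensity_real_le_of_le_one p hg _
  · exact withDensity_real_le_of_le_one q hg _

lemma lintegral_scale_apply (μ : Measure (AcProb lam)) {g : S → ℝ≥0∞} (hgm : Measurable g)
    (hg : ∀ s, g s ≤ 1) {F : Set S} (hF : MeasurableSet F) :
    ∫⁻ z, (AcProb.scale g hg z).toMeasure F ∂μ = (barycenter lam μ).withDensity g F := by
  rw [withDensity_apply _ hF, ← lintegral_indicator hF, barycenter,
    Measure.lintegral_bind (measurable_toMeasure lam).aemeasurable
      (hgm.indicator hF).aemeasurable]
  refine lintegral_congr fun z => ?_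
  rw [lintegral_indicator hF, ← withDensity_apply _ hF]
  rfl

lemma scale_add_scale_one_sub {g : S → ℝ≥0∞} (hgm : Measurable g) (hg : ∀ s, g s ≤ 1)
    (hg' : ∀ s, 1 - g s ≤ 1) (z : AcProb lam) :
    z.scale g hg + z.scale (fun s => 1 - g s) hg' = z.toAcFinite := by
  refine AcFinite.eq_of_toMeasure_eq ?_
  change z.toMeasure.withDensity g + z.toMeasure.withDensity (fun s => 1 - g s) = z.toMeasure
  rw [← withDensity_add_left hgm]
  have : (g + fun s => 1 - g s) = 1 := by
    funext s
    exact add_tsub_cancel_of_le (hg s)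
  rw [this, withDensity_one]

/-- A random probability `μ` can be modified so that its barycenter becomes any prescribed `π`, at a
cost of at most the total variation distance between the barycenters: each `z` is replaced by its
part `g z`, where `g` is the density of the common part of the barycenters, and the missing part of
`π` is added as a single atom. -/
lemma exists_barycenter_eq (μ : Measure (AcProb lam)) [IsProbabilityMeasure μ] (π : AcProb lam) :
    ∃ ν : Measure (AcProb lam), IsProbabilityMeasure ν ∧ barycenter lam ν = π.toMeasure ∧
      ∀ u : AcProb lam → ℝ, IsConeLipschitz u →
        |∫ z, u z ∂μ - ∫ z, u z ∂ν| ≤ tvDist (barycenter lam μ) π.toMeasure := by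
  obtain ⟨r, p, q, hr, hp, hq, e1, e2, h⟩ := exists_common_part (barycenter lam μ) π.toMeasure
  have hrb : r ≤ barycenter lam μ := e1 ▸ Measure.le_add_right le_rfl
  set g : S → ℝ≥0∞ := fun s => min (r.rnDeriv (barycenter lam μ) s) 1 with hgd
  have hgm : Measurable g := (Measure.measurable_rnDeriv _ _).min measurable_const
  have hg : ∀ s, g s ≤ 1 := fun s => min_le_right _ _
  have hgr : (barycenter lam μ).withDensity g = r := by
    have h1 : g =ᵐ[barycenter lam μ] r.rnDeriv (barycenter lam μ) := by
      filter_upwards [Measure.rnDeriv_le_one_of_le hrb] with s hs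
      exact min_eq_left hs
    rw [withDensity_congr_ae h1,
      Measure.withDensity_rnDeriv_eq _ _ (Measure.absolutelyContinuous_of_le hrb)]
  have hqπ : q ≪ lam := (Measure.absolutelyContinuous_of_le
    (e2 ▸ Measure.le_add_left le_rfl)).trans π.absolutelyContinuous
  set Q : AcFinite lam := ⟨q, hq, hqπ⟩ with hQ
  have hsm : Measurable (AcProb.scale (lam := lam) g hg) := (continuous_scale hg).measurable
  set κ : Measure (AcFinite lam) := μ.map (AcProb.scale g hg) + Measure.dirac Q with hκ
  have hκF : ∀ F, MeasurableSet F → ∫⁻ x, x.toMeasure F ∂κ = π.toMeasure F := by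
    intro F hF
    have hm : Measurable fun x : AcFinite lam => x.toMeasure F :=
      (continuous_apply lam hF).measurable
    rw [hκ, lintegral_add_measure, lintegral_map hm hsm, lintegral_dirac' _ hm,
      lintegral_scale_apply μ hgm hg hF, hgr, e2]
    rfl
  refine ⟨normalizedLaw π κ id, ⟨?_⟩, ?_, fun u hu => ?_⟩
  · rw [normalizedLaw_univ π κ measurable_id]
    exact (hκF _ .univ).trans measure_univ
  · refine Measure.ext fun F hF => ?_
    rw [barycenter_apply lam _ hF, lintegral_normalizedLaw_apply π κ measurable_id hF]
    exact hκF F hF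
  · have hcm := measurable_coneExt hu.measurable
    have hb : ∀ z : AcProb lam, |coneExt u (z.scale g hg)| ≤ 1 := fun z =>
      (hu.abs_coneExt_le _).trans ((withDensity_real_le_of_le_one z.toMeasure hg _).trans_eq probReal_univ)
    have hi : Integrable (fun z : AcProb lam => coneExt u (z.scale g hg)) μ :=
      Integrable.of_bound (hcm.comp hsm).aestronglyMeasurable 1 (Eventually.of_forall hb)
    have hi' : Integrable (coneExt u) (μ.map (AcProb.scale g hg)) :=
      (integrable_map_measure hcm.aestronglyMeasurable hsm.aemeasurable).2 hi
    have hid : Integrable (coneExt u) (Measure.dirac Q) :=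
      Integrable.of_bound (C := |coneExt u Q|) hcm.aestronglyMeasurable (by
        rw [ae_dirac_iff (measurableSet_le hcm.norm measurable_const)]
        exact le_rfl)
    have e3 : ∫ z, u z ∂(normalizedLaw π κ id) =
        ∫ z, coneExt u (AcProb.scale g hg z) ∂μ + coneExt u Q := by
      rw [integral_normalizedLaw π κ measurable_id hu.measurable]
      change ∫ x, coneExt u x ∂κ = _
      rw [hκ, integral_add_measure hi' hid, integral_map hsm.aemeasurable
        hcm.aestronglyMeasurable, integral_dirac' _ _ hcm.stronglyMeasurable]
    have hg' : ∀ s, 1 - g s ≤ 1 := fun s => tsub_le_self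
    have hgm' : Measurable fun s => 1 - g s := measurable_const.sub hgm
    have h1 : ∀ z : AcProb lam, |u z - coneExt u (z.scale g hg)| ≤
        ((z.scale (fun s => 1 - g s) hg').toMeasure Set.univ).toReal := fun z => by
      have := hu.abs_sub_le (z.scale g hg) (z.scale (fun s => 1 - g s) hg')
      rwa [scale_add_scale_one_sub hgm hg hg', coneExt_toAcFinite] at this
    have hmm : Measurable fun z : AcProb lam =>
        (z.scale (fun s => 1 - g s) hg').toMeasure Set.univ :=
      (continuous_apply lam .univ).measurable.comp (continuous_scale hg').measurable
    have h2 : ∫ z, ((AcProb.scale (fun s => 1 - g s) hg' z).toMeasure Set.univ).toReal ∂μ =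
        p.real Set.univ := by
      rw [integral_toReal hmm.aemeasurable (Eventually.of_forall fun z => measure_lt_top _ _),
        lintegral_scale_apply μ hgm' hg' .univ, ← measureReal_def]
      have hsum : r + (barycenter lam μ).withDensity (fun s => 1 - g s) = r + p := by
        rw [← e1]
        nth_rewrite 1 [← hgr]
        rw [← withDensity_add_left hgm]
        have : (g + fun s => 1 - g s) = 1 := by
          funext s
          exact add_tsub_cancel_of_le (hg s)
        rw [this, withDensity_one]
      have : IsFiniteMeasure ((barycenter lam μ).withDensity fun s => 1 - g s) :=
        isFiniteMeasure_of_le _ (withDensity_le_of_le_one _ hg')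
      have := congrArg (fun m : Measure S => m.real Set.univ) hsum
      rw [measureReal_add_apply, measureReal_add_apply] at this
      linarith
    have hid' : Integrable (fun z : AcProb lam =>
        ((z.scale (fun s => 1 - g s) hg').toMeasure Set.univ).toReal) μ :=
      Integrable.of_bound (C := 1) hmm.ennreal_toReal.aestronglyMeasurable
        (Eventually.of_forall fun z => by
          rw [Real.norm_of_nonneg ENNReal.toReal_nonneg]
          exact (withDensity_real_le_of_le_one z.toMeasure hg' _).trans_eq probReal_univ)
    have h3 : |∫ z, u z ∂μ - ∫ z, coneExt u (AcProb.scale g hg z) ∂μ| ≤ p.real Set.univ := by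
      rw [← integral_sub (hu.integrable μ) hi, ← h2]
      exact (abs_integral_le_integral_abs).trans
        (integral_mono ((hu.integrable μ).sub hi).abs hid' h1)
    have h4 : |coneExt u Q| ≤ q.real Set.univ := hu.abs_coneExt_le Q
    rw [e3]
    refine le_trans ?_ h
    rw [abs_le] at *
    constructor <;> linarith

end Barycenter

/-! ### Powers of a Markov kernel -/

section Powers

variable {X : Type*} [MeasurableSpace X]

lemma pow_succ_eq_comp (κ : Kernel X X) (n : ℕ) : κ ^ (n + 1) = (κ ^ n).comp κ := pow_succ κ n

lemma pow_add_eq_comp (κ : Kernel X X) (m n : ℕ) : κ ^ (m + n) = (κ ^ n).comp (κ ^ m) := by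
  rw [add_comm, pow_add]; rfl

lemma pow_succ_apply (κ : Kernel X X) (n : ℕ) (x : X) :
    (κ ^ (n + 1)) x = ((κ ^ n) x).bind κ := by
  rw [pow_add_eq_comp, pow_one, Kernel.comp_apply]

lemma bind_pow_add (μ : Measure X) (κ : Kernel X X) (m n : ℕ) :
    μ.bind ⇑(κ ^ (m + n)) = (μ.bind ⇑(κ ^ m)).bind ⇑(κ ^ n) := by
  rw [Measure.comp_assoc, pow_add_eq_comp]

lemma bind_pow_succ (μ : Measure X) (κ : Kernel X X) (n : ℕ) :
    μ.bind ⇑(κ ^ (n + 1)) = (μ.bind ⇑(κ ^ n)).bind κ := by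
  rw [bind_pow_add, pow_one]

lemma bind_pow_zero (μ : Measure X) (κ : Kernel X X) : μ.bind ⇑(κ ^ 0) = μ := by
  rw [pow_zero]
  exact Measure.id_comp

lemma integral_bind_kernel (μ : Measure X) [IsProbabilityMeasure μ] (κ : Kernel X X)
    [IsMarkovKernel κ] {f : X → ℝ} (hf : Measurable f) {C : ℝ} (hC : ∀ x, |f x| ≤ C) :
    ∫ x, f x ∂(μ.bind κ) = ∫ x, ∫ y, f y ∂(κ x) ∂μ := by
  have hi : Integrable f ((κ.comp (Kernel.const Unit μ)) ()) :=
    Integrable.of_bound hf.aestronglyMeasurable C (Eventually.of_forall hC)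
  have h := Kernel.integral_comp hi
  rwa [Kernel.comp_apply, Kernel.const_apply] at h

lemma integral_pow_add (κ : Kernel X X) [IsMarkovKernel κ] {f : X → ℝ} (hf : Measurable f) {C : ℝ}
    (hC : ∀ x, |f x| ≤ C) (m n : ℕ) (x : X) :
    ∫ y, f y ∂((κ ^ (m + n)) x) = ∫ z, ∫ y, f y ∂((κ ^ n) z) ∂((κ ^ m) x) := by
  rw [pow_add_eq_comp, Kernel.comp_apply, integral_bind_kernel _ _ hf hC]

lemma abs_integral_kernel_le {f : X → ℝ} {C : ℝ} (hC : ∀ x, |f x| ≤ C) (κ : Kernel X X)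
    [IsMarkovKernel κ] (x : X) : |∫ y, f y ∂(κ x)| ≤ C := by
  have := norm_integral_le_of_norm_le_const (μ := κ x) (f := f) (Eventually.of_forall hC)
  simpa using this

end Powers

/-! ### The operators of a hidden Markov model -/

namespace DensityHMM

variable {S A : Type*} [MeasurableSpace S] [MeasurableSpace A] (H : DensityHMM S A)

instance : IsMarkovKernel H.markovKernel :=
  inferInstanceAs (IsMarkovKernel H.M.fst)

lemma measurable_density :
    Measurable fun q : S × S × A => (H.m q.1 q.2.1 q.2.2 : ℝ≥0∞) :=
  H.measurable_m.coe_nnreal_ennreal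

/-- The density `f(s, t) = ∫ m(s, t, a) τ(da)` of the hidden Markov kernel. -/
def hiddenDensity (q : S × S) : ℝ≥0∞ := ∫⁻ a, (H.m q.1 q.2 a : ℝ≥0∞) ∂H.tau

lemma measurable_hiddenDensity : Measurable H.hiddenDensity := by
  have : Measurable fun p : (S × S) × A => (H.m p.1.1 p.1.2 p.2 : ℝ≥0∞) :=
    H.measurable_density.comp
      (by fun_prop : Measurable fun p : (S × S) × A => (p.1.1, p.1.2, p.2))
  exact this.lintegral_prod_right'

lemma markovKernel_apply (s : S) {F : Set S} (hF : MeasurableSet F) :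
    H.markovKernel s F = ∫⁻ t in F, H.hiddenDensity (s, t) ∂H.lam := by
  have h := H.M_apply s F Set.univ hF .univ
  rw [Set.prod_univ] at h
  rw [HMM.markovKernel, Kernel.fst_apply' _ _ hF]
  rw [Measure.restrict_univ] at h
  exact h

/-- Summing over the observations gives the hidden chain: `∫ x M_a τ(da) = x P`. -/
lemma lintegral_op_apply (x : Measure S) [SFinite x] {F : Set S} (hF : MeasurableSet F) :
    ∫⁻ a, H.op x a F ∂H.tau = x.bind H.markovKernel F := by
  have hm := H.measurable_density
  rw [Measure.bind_apply hF (Kernel.aemeasurable _)]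
  have h1 : ∀ a, H.op x a F = ∫⁻ s, ∫⁻ t in F, (H.m s t a : ℝ≥0∞) ∂H.lam ∂x := by
    intro a
    rw [H.op_apply x a hF]
    refine lintegral_lintegral_swap (Measurable.aemeasurable ?_)
    exact hm.comp (by fun_prop : Measurable fun q : S × S => (q.2, q.1, a))
  simp_rw [h1]
  rw [lintegral_lintegral_swap]
  · refine lintegral_congr fun s => ?_
    rw [lintegral_lintegral_swap, H.markovKernel_apply s hF]
    · rfl
    · exact (hm.comp (by fun_prop : Measurable fun q : A × S => (s, q.2, q.1))).aemeasurable
  · refine Measurable.aemeasurable ?_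
    have : Measurable fun q : (A × S) × S => (H.m q.1.2 q.2 q.1.1 : ℝ≥0∞) :=
      hm.comp (by fun_prop : Measurable fun q : (A × S) × S => (q.1.2, q.2, q.1.1))
    exact this.lintegral_prod_right'

lemma op_add (x y : Measure S) [SFinite x] (a : A) : H.op (x + y) a = H.op x a + H.op y a := by
  refine Measure.ext fun F hF => ?_
  rw [Measure.add_apply, H.op_apply _ a hF, H.op_apply _ a hF, H.op_apply _ a hF]
  simp_rw [lintegral_add_measure]
  have : Measurable fun q : S × S => (H.m q.2 q.1 a : ℝ≥0∞) :=
    H.measurable_density.comp (by fun_prop : Measurable fun q : S × S => (q.2, q.1, a))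
  exact lintegral_add_left this.lintegral_prod_right' _

lemma op_smul (c : ℝ≥0) (x : Measure S) (a : A) : H.op (c • x) a = c • H.op x a := by
  refine Measure.ext fun F hF => ?_
  rw [Measure.smul_apply, H.op_apply _ a hF, H.op_apply _ a hF]
  simp_rw [lintegral_smul_measure, ENNReal.smul_def, smul_eq_mul]
  exact lintegral_const_mul' _ _ ENNReal.coe_ne_top

variable {H}

lemma barycenter_dirac (x : AcProb H.lam) :
    barycenter H.lam (Measure.dirac x) = x.toMeasure :=
  Measure.dirac_bind (measurable_toMeasure _) x

variable [TopologicalSpace A]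

lemma Regular.opAcFinite_add (hH : H.Regular) (x y : AcFinite H.lam) (a : A) :
    H.opAcFinite hH.isFiniteMeasure_op (x + y, a) =
      H.opAcFinite hH.isFiniteMeasure_op (x, a) + H.opAcFinite hH.isFiniteMeasure_op (y, a) :=
  AcFinite.eq_of_toMeasure_eq (H.op_add _ _ a)

lemma Regular.opAcFinite_smul (hH : H.Regular) (c : ℝ≥0) (x : AcFinite H.lam) (a : A) :
    H.opAcFinite hH.isFiniteMeasure_op (c • x, a) =
      c • H.opAcFinite hH.isFiniteMeasure_op (x, a) :=
  AcFinite.eq_of_toMeasure_eq (H.op_smul _ _ a)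

lemma Regular.measurable_opAcFinite [OpensMeasurableSpace A] (hH : H.Regular)
    (x : AcFinite H.lam) :
    Measurable fun a => H.opAcFinite hH.isFiniteMeasure_op (x, a) :=
  (hH.continuous_op.comp (Continuous.prodMk_right x)).measurable

lemma Regular.integrable_mass_op [OpensMeasurableSpace A] (hH : H.Regular)
    (x : AcFinite H.lam) :
    Integrable (fun a => (H.opAcFinite hH.isFiniteMeasure_op (x, a)).mass) H.tau ∧
      ∫ a, (H.opAcFinite hH.isFiniteMeasure_op (x, a)).mass ∂H.tau = x.mass := by
  have hm : Measurable fun a => (H.opAcFinite hH.isFiniteMeasure_op (x, a)).toMeasure Set.univ :=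
    measurable_apply_of_measurable (hH.measurable_opAcFinite x) .univ
  have h1 : ∫⁻ a, (H.opAcFinite hH.isFiniteMeasure_op (x, a)).toMeasure Set.univ ∂H.tau =
      x.toMeasure Set.univ :=
    (H.lintegral_op_apply x.toMeasure .univ).trans Measure.comp_apply_univ
  refine ⟨integrable_toReal_of_lintegral_ne_top hm.aemeasurable
    (h1 ▸ measure_ne_top _ _), ?_⟩
  refine (integral_toReal hm.aemeasurable
    (Eventually.of_forall fun a => measure_lt_top _ _)).trans ?_
  rw [h1]
  rfl

lemma Regular.integrable_coneExt_op [OpensMeasurableSpace A] (hH : H.Regular)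
    {u : AcProb H.lam → ℝ}
    (hu : IsConeLipschitz u) (x : AcFinite H.lam) :
    Integrable (fun a => coneExt u (H.opAcFinite hH.isFiniteMeasure_op (x, a))) H.tau :=
  (hH.integrable_mass_op x).1.mono'
    ((measurable_coneExt hu.measurable).comp (hH.measurable_opAcFinite x)).aestronglyMeasurable
    (Eventually.of_forall fun _ => hu.abs_coneExt_le _)

variable [PolishSpace A] [BorelSpace A]

lemma Regular.filterKernel_eq_normalizedLaw (hH : H.Regular) (x : AcProb H.lam) :
    hH.filterKernel x = normalizedLaw x H.tau
      fun a => H.opAcFinite hH.isFiniteMeasure_op (x.toAcFinite, a) := rfl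

lemma Regular.integral_filterKernel (hH : H.Regular) (x : AcProb H.lam) {u : AcProb H.lam → ℝ}
    (hu : Measurable u) : ∫ z, u z ∂(hH.filterKernel x) =
      ∫ a, coneExt u (H.opAcFinite hH.isFiniteMeasure_op (x.toAcFinite, a)) ∂H.tau := by
  rw [hH.filterKernel_eq_normalizedLaw]
  exact integral_normalizedLaw x H.tau (hH.measurable_opAcFinite _) hu

/-- The expected value of the filter is the law of the next hidden state. -/
lemma Regular.lintegral_filterKernel_apply (hH : H.Regular) (x : AcProb H.lam) {F : Set S}
    (hF : MeasurableSet F) : ∫⁻ z, z.toMeasure F ∂(hH.filterKernel x) =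
      x.toMeasure.bind H.markovKernel F := by
  rw [hH.filterKernel_eq_normalizedLaw,
    lintegral_normalizedLaw_apply x H.tau (hH.measurable_opAcFinite _) hF,
    ← H.lintegral_op_apply _ hF]
  rfl

lemma Regular.barycenter_bind (hH : H.Regular) (μ : Measure (AcProb H.lam)) :
    barycenter H.lam (μ.bind hH.filterKernel) = (barycenter H.lam μ).bind H.markovKernel := by
  refine Measure.ext fun F hF => ?_
  have hm : Measurable fun z : AcProb H.lam => z.toMeasure F :=
    (Measure.measurable_coe hF).comp (measurable_toMeasure H.lam)
  rw [barycenter_apply _ _ hF, Measure.lintegral_bind (Kernel.aemeasurable _) hm.aemeasurable,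
    Measure.bind_apply hF (Kernel.aemeasurable _), barycenter,
    Measure.lintegral_bind (measurable_toMeasure _).aemeasurable
      (Kernel.measurable_coe _ hF).aemeasurable]
  refine lintegral_congr fun z => ?_
  rw [hH.lintegral_filterKernel_apply z hF, Measure.bind_apply hF (Kernel.aemeasurable _)]

lemma Regular.barycenter_bind_pow (hH : H.Regular) (μ : Measure (AcProb H.lam)) (n : ℕ) :
    barycenter H.lam (μ.bind ⇑(hH.filterKernel ^ n)) =
      (barycenter H.lam μ).bind ⇑(H.markovKernel ^ n) := by
  induction n with
  | zero => rw [bind_pow_zero, bind_pow_zero]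
  | succ n ih => rw [bind_pow_succ, hH.barycenter_bind, ih, bind_pow_succ]

lemma Regular.barycenter_pow (hH : H.Regular) (x : AcProb H.lam) (n : ℕ) :
    barycenter H.lam ((hH.filterKernel ^ n) x) = x.toMeasure.bind ⇑(H.markovKernel ^ n) := by
  rw [← barycenter_dirac x, ← hH.barycenter_bind_pow,
    Measure.dirac_bind (Kernel.measurable _)]

/-- On the homogeneous extension the filter kernel acts as the positive linear map
`w ↦ ∫ w(· M_a) τ(da)`: the normalizations cancel. -/
lemma Regular.coneExt_integral_filterKernel (hH : H.Regular) {u : AcProb H.lam → ℝ}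
    (hu : Measurable u) (x : AcFinite H.lam) :
    coneExt (fun z => ∫ y, u y ∂(hH.filterKernel z)) x =
      ∫ a, coneExt u (H.opAcFinite hH.isFiniteMeasure_op (x, a)) ∂H.tau := by
  by_cases h : x.toMeasure Set.univ ≠ 0
  · rw [coneExt_of_ne_zero _ h, hH.integral_filterKernel _ hu, ← integral_const_mul]
    refine integral_congr_ae (Eventually.of_forall fun a => ?_)
    have e : (x.mass.toNNReal : ℝ) = x.mass := Real.coe_toNNReal _ x.mass_nonneg
    nth_rewrite 3 [← x.smul_normalize h]
    simp only
    rw [hH.opAcFinite_smul, coneExt_smul, e]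
  · rw [coneExt_of_eq_zero _ h]
    have e : ∀ a, coneExt u (H.opAcFinite hH.isFiniteMeasure_op (x, a)) = 0 := fun _ => by
      have h0 : x = (0 : ℝ≥0) • x := by
        refine AcFinite.eq_of_toMeasure_eq ?_
        rw [AcFinite.smul_toMeasure, zero_smul]
        exact Measure.measure_univ_eq_zero.1 (not_not.1 h)
      rw [h0, hH.opAcFinite_smul, coneExt_smul]
      simp
    simp [e]

lemma Regular.isConeLipschitz_integral (hH : H.Regular) {u : AcProb H.lam → ℝ}
    (hu : IsConeLipschitz u) : IsConeLipschitz fun z => ∫ y, u y ∂(hH.filterKernel z) := by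
  refine ⟨(hu.measurable.stronglyMeasurable.integral_kernel).measurable, fun r p => ?_⟩
  rw [hH.coneExt_integral_filterKernel hu.measurable,
    hH.coneExt_integral_filterKernel hu.measurable,
    ← integral_sub (hH.integrable_coneExt_op hu _) (hH.integrable_coneExt_op hu _),
    ← (hH.integrable_mass_op p).2]
  refine abs_integral_le_integral_abs.trans (integral_mono
    ((hH.integrable_coneExt_op hu _).sub (hH.integrable_coneExt_op hu _)).abs
    (hH.integrable_mass_op p).1 fun _ => ?_)
  simp only
  rw [hH.opAcFinite_add]
  exact hu.abs_sub_le _ _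

/-- Equicontinuity: all powers of the filter kernel preserve the class of test functions. -/
lemma Regular.isConeLipschitz_integral_pow (hH : H.Regular) {u : AcProb H.lam → ℝ}
    (hu : IsConeLipschitz u) (n : ℕ) :
    IsConeLipschitz fun z => ∫ y, u y ∂((hH.filterKernel ^ n) z) := by
  induction n generalizing u with
  | zero =>
    have : (fun z => ∫ y, u y ∂((hH.filterKernel ^ 0) z)) = u := by
      funext z
      rw [pow_zero]
      change ∫ y, u y ∂(Kernel.id z) = u z
      rw [Kernel.id_apply, integral_dirac' _ _ hu.measurable.stronglyMeasurable]
    rw [this]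
    exact hu
  | succ n ih =>
    have : (fun z => ∫ y, u y ∂((hH.filterKernel ^ (n + 1)) z)) =
        fun z => ∫ y, ∫ y', u y' ∂((hH.filterKernel ^ n) y) ∂(hH.filterKernel z) := by
      funext z
      rw [pow_succ_eq_comp, Kernel.comp_apply,
        integral_bind_kernel _ _ hu.measurable hu.abs_le_one]
    rw [this]
    exact hH.isConeLipschitz_integral (ih hu)

end DensityHMM

/-! ### Convergence of the hidden chain -/

section TotalVariationDensity

variable {X Y : Type*} [MeasurableSpace X] [MeasurableSpace Y]

lemma iSup_real_sub_eq_of_hahn (μ ν : Measure X) [IsFiniteMeasure μ] [IsFiniteMeasure ν]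
    {E : Set X} (hE : MeasurableSet E)
    (h1 : ∀ F, MeasurableSet F → F ⊆ E → ν F ≤ μ F)
    (h2 : ∀ F, MeasurableSet F → F ⊆ Eᶜ → μ F ≤ ν F) :
    (⨆ F : {F : Set X // MeasurableSet F}, (μ.real F.1 - ν.real F.1)) = μ.real E - ν.real E := by
  refine le_antisymm (ciSup_le fun F => ?_) (real_sub_le_iSup μ ν hE)
  have a1 : ν.real (E \ F.1) ≤ μ.real (E \ F.1) :=
    ENNReal.toReal_mono (measure_ne_top _ _) (h1 _ (hE.diff F.2) Set.sdiff_subset)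
  have a2 : μ.real (F.1 \ E) ≤ ν.real (F.1 \ E) :=
    ENNReal.toReal_mono (measure_ne_top _ _) (h2 _ (F.2.diff hE) fun x hx => hx.2)
  have b1 := measureReal_inter_add_sdiff (μ := μ) (s := F.1) hE
  have b2 := measureReal_inter_add_sdiff (μ := ν) (s := F.1) hE
  have b3 := measureReal_inter_add_sdiff (μ := μ) (s := E) F.2
  have b4 := measureReal_inter_add_sdiff (μ := ν) (s := E) F.2
  rw [Set.inter_comm] at b3 b4
  linarith

/-- Total variation distances between measures with jointly measurable densities depend measurably
on the parameter: the set where one density dominates the other attains both suprema. -/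
lemma measurable_tvDist_of_density (lam : Measure Y) [SFinite lam] (κ : Kernel X Y)
    [IsMarkovKernel κ] (π : Measure Y) [IsFiniteMeasure π] {f : X × Y → ℝ≥0∞} (hf : Measurable f)
    (hκ : ∀ x, κ x = lam.withDensity fun y => f (x, y)) {h : Y → ℝ≥0∞} (hh : Measurable h)
    (hπ : π = lam.withDensity h) : Measurable fun x => tvDist (κ x) π := by
  have hE : MeasurableSet {p : X × Y | h p.2 ≤ f p} := measurableSet_le (hh.comp measurable_snd) hf
  have hEx : ∀ x, MeasurableSet (Prod.mk x ⁻¹' {p : X × Y | h p.2 ≤ f p}) := fun x =>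
    measurable_prodMk_left hE
  have key : ∀ x, tvDist (κ x) π =
      ((κ x).real (Prod.mk x ⁻¹' {p : X × Y | h p.2 ≤ f p})
        - π.real (Prod.mk x ⁻¹' {p : X × Y | h p.2 ≤ f p})) +
      (π.real (Prod.mk x ⁻¹' {p : X × Y | h p.2 ≤ f p}ᶜ)
        - (κ x).real (Prod.mk x ⁻¹' {p : X × Y | h p.2 ≤ f p}ᶜ)) := by
    intro x
    have h1 : ∀ F, MeasurableSet F → F ⊆ Prod.mk x ⁻¹' {p : X × Y | h p.2 ≤ f p} →
        π F ≤ κ x F := by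
      intro F hF hFE
      rw [hπ, hκ, withDensity_apply _ hF, withDensity_apply _ hF]
      exact setLIntegral_mono' hF fun y hy => hFE hy
    have h2 : ∀ F, MeasurableSet F → F ⊆ (Prod.mk x ⁻¹' {p : X × Y | h p.2 ≤ f p})ᶜ →
        κ x F ≤ π F := by
      intro F hF hFE
      rw [hπ, hκ, withDensity_apply _ hF, withDensity_apply _ hF]
      exact setLIntegral_mono' hF fun y hy =>
        (not_le.1 (show ¬ h y ≤ f (x, y) from hFE hy)).le
    rw [tvDist, iSup_real_sub_eq_of_hahn (κ x) π (hEx x) h1 h2,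
      iSup_real_sub_eq_of_hahn π (κ x) (hEx x).compl h2 (by rwa [compl_compl])]
    rfl
  simp_rw [key]
  have m1 : ∀ {E : Set (X × Y)}, MeasurableSet E →
      Measurable fun x => (κ x).real (Prod.mk x ⁻¹' E) := fun hE =>
    (Kernel.measurable_kernel_prodMk_left hE).ennreal_toReal
  have m2 : ∀ {E : Set (X × Y)}, MeasurableSet E →
      Measurable fun x => π.real (Prod.mk x ⁻¹' E) := fun hE =>
    (measurable_measure_prodMk_left hE).ennreal_toReal
  exact ((m1 hE).sub (m2 hE)).add ((m2 hE.compl).sub (m1 hE.compl))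

lemma tvDist_bind_le_integral (x : Measure X) [IsProbabilityMeasure x] (κ : Kernel X Y)
    [IsMarkovKernel κ] (π : Measure Y) [IsProbabilityMeasure π]
    (hm : Measurable fun s => tvDist (κ s) π) :
    tvDist (x.bind κ) π ≤ 2 * ∫ s, tvDist (κ s) π ∂x := by
  rw [two_mul]
  refine tvDist_le_of_forall _ _ fun F hF => ?_
  have hmF : Measurable fun s => (κ s).real F := (Kernel.measurable_coe κ hF).ennreal_toReal
  have hi : Integrable (fun s => (κ s).real F) x :=
    Integrable.of_bound (C := 1) hmF.aestronglyMeasurable (Eventually.of_forall fun s => by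
      rw [Real.norm_of_nonneg measureReal_nonneg]; exact measureReal_le_one)
  have e1 : (x.bind κ).real F = ∫ s, (κ s).real F ∂x := by
    rw [measureReal_def, Measure.bind_apply hF κ.aemeasurable]
    exact (integral_toReal (Kernel.measurable_coe κ hF).aemeasurable
      (Eventually.of_forall fun s => measure_lt_top _ _)).symm
  have e2 : π.real F = ∫ _, π.real F ∂x := by simp
  rw [e1, e2, ← integral_sub hi (integrable_const _)]
  refine abs_integral_le_integral_abs.trans (integral_mono (hi.sub (integrable_const _)).abs ?_
    fun s => abs_real_sub_le_tvDist (κ s) π hF)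
  exact Integrable.of_bound (C := 2) hm.aestronglyMeasurable (Eventually.of_forall fun s => by
    rw [Real.norm_of_nonneg (tvDist_nonneg _ _)]; exact tvDist_le_two _ _)

end TotalVariationDensity

namespace DensityHMM

variable {S A : Type*} [MeasurableSpace S] [MeasurableSpace A] {H : DensityHMM S A}

/-- The powers of the hidden Markov kernel have jointly measurable densities. -/
lemma exists_density_pow_succ (H : DensityHMM S A) (n : ℕ) :
    ∃ f : S × S → ℝ≥0∞, Measurable f ∧
      ∀ s, (H.markovKernel ^ (n + 1)) s = H.lam.withDensity fun t => f (s, t) := by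
  have hm : Measurable fun q : (S × S) × S => H.hiddenDensity (q.2, q.1.2) :=
    H.measurable_hiddenDensity.comp
      (by fun_prop : Measurable fun q : (S × S) × S => (q.2, q.1.2))
  refine ⟨fun q => ∫⁻ r, H.hiddenDensity (r, q.2) ∂((H.markovKernel ^ n) q.1), ?_, fun s => ?_⟩
  · exact Measurable.lintegral_kernel_prod_right' (κ := (H.markovKernel ^ n).comap Prod.fst
      measurable_fst) hm
  · refine Measure.ext fun F hF => ?_
    rw [pow_succ_apply, Measure.bind_apply hF (Kernel.aemeasurable _), withDensity_apply _ hF]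
    simp_rw [H.markovKernel_apply _ hF]
    refine lintegral_lintegral_swap ?_
    exact H.measurable_hiddenDensity.aemeasurable

lemma pow_succ_absolutelyContinuous (n : ℕ) (s : S) : (H.markovKernel ^ (n + 1)) s ≪ H.lam := by
  obtain ⟨f, -, h⟩ := H.exists_density_pow_succ n
  rw [h]
  exact withDensity_absolutelyContinuous _ _

end DensityHMM

namespace StronglyErgodic

lemma nonempty {X : Type*} [MeasurableSpace X] {Q : Kernel X X} {π : Measure X}
    (h : StronglyErgodic Q π) : Nonempty X := by
  have := h.isProbabilityMeasure
  exact nonempty_of_isProbabilityMeasure π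

lemma bind_eq {X : Type*} [MeasurableSpace X] {Q : Kernel X X} [IsMarkovKernel Q]
    {π : Measure X} (h : StronglyErgodic Q π) : π.bind Q = π := by
  have := h.isProbabilityMeasure
  obtain ⟨s⟩ := h.nonempty
  refine eq_of_tvDist_eq_zero _ _ (le_antisymm ?_ (tvDist_nonneg _ _))
  have h1 : Tendsto (fun n : ℕ => tvDist ((Q ^ n) s) π + tvDist ((Q ^ (n + 1)) s) π) atTop
      (𝓝 (0 + 0)) := (h.tendsto s).add ((h.tendsto s).comp (tendsto_add_atTop_nat 1))
  rw [add_zero] at h1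
  refine ge_of_tendsto h1 (Eventually.of_forall fun n => ?_)
  have h2 := tvDist_triangle (π.bind Q) ((Q ^ (n + 1)) s) π
  have h3 := tvDist_bind_le π ((Q ^ n) s) Q
  rw [← pow_succ_apply, tvDist_comm π] at h3
  linarith

lemma bind_pow_eq {X : Type*} [MeasurableSpace X] {Q : Kernel X X} [IsMarkovKernel Q]
    {π : Measure X} (h : StronglyErgodic Q π) (n : ℕ) : π.bind ⇑(Q ^ n) = π := by
  induction n with
  | zero => exact bind_pow_zero π Q
  | succ n ih => rw [bind_pow_succ, ih, h.bind_eq]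

variable {S A : Type*} [MeasurableSpace S] [MeasurableSpace A] {H : DensityHMM S A}
  {π : Measure S}

lemma absolutelyContinuous (h : StronglyErgodic H.markovKernel π) : π ≪ H.lam := by
  have := h.isProbabilityMeasure
  obtain ⟨s⟩ := h.nonempty
  refine Measure.AbsolutelyContinuous.mk fun F hF h0 => ?_
  have h1 : ∀ n : ℕ, π.real F ≤ tvDist ((H.markovKernel ^ (n + 1)) s) π := fun n => by
    have h2 := abs_real_sub_le_tvDist ((H.markovKernel ^ (n + 1)) s) π hF
    have h3 : ((H.markovKernel ^ (n + 1)) s).real F = 0 := by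
      rw [measureReal_def, DensityHMM.pow_succ_absolutelyContinuous n s h0, ENNReal.toReal_zero]
    rw [h3, zero_sub, abs_neg] at h2
    exact (le_abs_self _).trans h2
  have h4 : π.real F ≤ 0 :=
    ge_of_tendsto ((h.tendsto s).comp (tendsto_add_atTop_nat 1)) (Eventually.of_forall h1)
  exact (measureReal_eq_zero_iff).1 (le_antisymm h4 measureReal_nonneg)

/-- The limit measure as a point of the space of absolutely continuous probabilities. -/
def limit (h : StronglyErgodic H.markovKernel π) : AcProb H.lam :=
  ⟨π, h.isProbabilityMeasure, h.absolutelyContinuous⟩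

lemma measurable_tvDist (h : StronglyErgodic H.markovKernel π) (n : ℕ) :
    Measurable fun s => tvDist ((H.markovKernel ^ (n + 1)) s) π := by
  have := h.isProbabilityMeasure
  obtain ⟨f, hf, hκ⟩ := H.exists_density_pow_succ n
  exact measurable_tvDist_of_density H.lam _ π hf hκ (Measure.measurable_rnDeriv π H.lam)
    (Measure.withDensity_rnDeriv_eq _ _ h.absolutelyContinuous).symm

lemma tendsto_integral_tvDist (h : StronglyErgodic H.markovKernel π) (x : Measure S)
    [IsProbabilityMeasure x] :
    Tendsto (fun n : ℕ => ∫ s, tvDist ((H.markovKernel ^ (n + 1)) s) π ∂x) atTop (𝓝 0) := by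
  have := h.isProbabilityMeasure
  have h1 : Tendsto (fun n : ℕ => ∫ s, tvDist ((H.markovKernel ^ (n + 1)) s) π ∂x) atTop
      (𝓝 (∫ _, (0 : ℝ) ∂x)) := by
    refine tendsto_integral_of_dominated_convergence (fun _ => 2)
      (fun n => (h.measurable_tvDist n).aestronglyMeasurable) (integrable_const _)
      (fun n => Eventually.of_forall fun s => ?_) (Eventually.of_forall fun s => ?_)
    · rw [Real.norm_of_nonneg (tvDist_nonneg _ _)]
      exact tvDist_le_two _ _
    · exact (h.tendsto s).comp (tendsto_add_atTop_nat 1)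
  simpa using h1

lemma tvDist_bind_pow_le (h : StronglyErgodic H.markovKernel π) (x : Measure S)
    [IsProbabilityMeasure x] (n : ℕ) :
    tvDist (x.bind ⇑(H.markovKernel ^ (n + 1))) π ≤
      2 * ∫ s, tvDist ((H.markovKernel ^ (n + 1)) s) π ∂x := by
  have := h.isProbabilityMeasure
  exact tvDist_bind_le_integral x _ π (h.measurable_tvDist n)

lemma tendsto_tvDist_bind (h : StronglyErgodic H.markovKernel π) (x : Measure S)
    [IsProbabilityMeasure x] :
    Tendsto (fun n : ℕ => tvDist (x.bind ⇑(H.markovKernel ^ (n + 1))) π) atTop (𝓝 0) := by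
  have := h.isProbabilityMeasure
  have h1 := (h.tendsto_integral_tvDist x).const_mul 2
  rw [mul_zero] at h1
  exact squeeze_zero (fun n => tvDist_nonneg _ _) (fun n => h.tvDist_bind_pow_le x n) h1

end StronglyErgodic

/-! ### Contraction under Condition E -/

namespace IsCoupling

variable {X Y : Type*} [MeasurableSpace X] [MeasurableSpace Y] {γ : Measure (X × Y)}
  {μ : Measure X} {ν : Measure Y}

lemma map_fst (h : IsCoupling γ μ ν) : γ.map Prod.fst = μ := by
  refine Measure.ext fun F hF => ?_
  rw [Measure.map_apply measurable_fst hF, ← h.left F hF, Set.prod_univ]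

lemma map_snd (h : IsCoupling γ μ ν) : γ.map Prod.snd = ν := by
  refine Measure.ext fun F hF => ?_
  rw [Measure.map_apply measurable_snd hF, ← h.right F hF, Set.univ_prod]

end IsCoupling

/-- If `f ≤ ρ` on a set of outer measure at least `α` and `f ≤ ε + e` everywhere, where `ρ ≤ ε`,
then `∫ f ≤ αρ + (1 - α)ε + ∫ e`. -/
lemma integral_le_of_le_on {Ω : Type*} [MeasurableSpace Ω] (γ : Measure Ω) [IsProbabilityMeasure γ]
    {f e : Ω → ℝ} (hfm : Measurable f) (hf : Integrable f γ) (he : Integrable e γ)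
    (he0 : ∀ ω, 0 ≤ e ω) {α ρ ε : ℝ} (hρε : ρ ≤ ε) {B : Set Ω}
    (hB : ENNReal.ofReal α ≤ γ B) (hfB : ∀ ω ∈ B, f ω ≤ ρ) (hfe : ∀ ω, f ω ≤ ε + e ω) :
    ∫ ω, f ω ∂γ ≤ α * ρ + (1 - α) * ε + ∫ ω, e ω ∂γ := by
  -- enlarging `B` to the sublevel set of `f` makes it measurable
  set C : Set Ω := {ω | f ω ≤ ρ} with hC
  have hCm : MeasurableSet C := measurableSet_le hfm measurable_const
  have hαC : α ≤ γ.real C := by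
    refine (ENNReal.ofReal_le_iff_le_toReal (measure_ne_top γ C)).1 ?_
    exact hB.trans (measure_mono hfB)
  have hint : Integrable (C.indicator fun _ => ε - ρ) γ := (integrable_const _).indicator hCm
  have hint' : Integrable (fun ω => ε - C.indicator (fun _ => ε - ρ) ω) γ :=
    (integrable_const _).sub hint
  calc ∫ ω, f ω ∂γ ≤ ∫ ω, ((ε - C.indicator (fun _ => ε - ρ) ω) + e ω) ∂γ := by
        refine integral_mono hf (hint'.add he) fun ω => ?_
        by_cases hω : ω ∈ C
        · have h1 : f ω ≤ ρ := hω
          have h2 := he0 ω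
          simp only [Set.indicator_of_mem hω]
          linarith
        · simp only [Set.indicator_of_notMem hω]
          linarith [hfe ω]
    _ = ε - γ.real C * (ε - ρ) + ∫ ω, e ω ∂γ := by
        rw [integral_add hint' he,
          integral_sub (integrable_const _) hint, integral_indicator_const _ hCm]
        simp
    _ ≤ α * ρ + (1 - α) * ε + ∫ ω, e ω ∂γ := by nlinarith

namespace DensityHMM

variable {S A : Type*} [MeasurableSpace S] [MeasurableSpace A] {H : DensityHMM S A}
  [TopologicalSpace A] [PolishSpace A] [BorelSpace A] {π : Measure S}

/-- After `n` steps of the filter, any two initial laws with barycenter `π` are `ε`-close on all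
test functions. -/
def Regular.GapLE (hH : H.Regular) (π : Measure S) (n : ℕ) (ε : ℝ) : Prop :=
  ∀ u : AcProb H.lam → ℝ, IsConeLipschitz u → ∀ μ ν : Measure (AcProb H.lam),
    IsProbabilityMeasure μ → IsProbabilityMeasure ν →
    barycenter H.lam μ = π → barycenter H.lam ν = π →
      ∫ z, u z ∂(μ.bind ⇑(hH.filterKernel ^ n)) - ∫ z, u z ∂(ν.bind ⇑(hH.filterKernel ^ n)) ≤ ε

lemma Regular.integral_bind_pow_add (hH : H.Regular) {u : AcProb H.lam → ℝ}
    (hu : IsConeLipschitz u) (μ : Measure (AcProb H.lam)) [IsProbabilityMeasure μ] (m n : ℕ) :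
    ∫ z, u z ∂(μ.bind ⇑(hH.filterKernel ^ (m + n))) =
      ∫ z, ∫ y, u y ∂((hH.filterKernel ^ n) z) ∂(μ.bind ⇑(hH.filterKernel ^ m)) := by
  rw [bind_pow_add, integral_bind_kernel _ _ hu.measurable hu.abs_le_one]

lemma Regular.integral_bind_pow (hH : H.Regular) {u : AcProb H.lam → ℝ}
    (hu : IsConeLipschitz u) (μ : Measure (AcProb H.lam)) [IsProbabilityMeasure μ] (n : ℕ) :
    ∫ z, u z ∂(μ.bind ⇑(hH.filterKernel ^ n)) =
      ∫ z, ∫ y, u y ∂((hH.filterKernel ^ n) z) ∂μ :=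
  integral_bind_kernel _ _ hu.measurable hu.abs_le_one

lemma Regular.gapLE_two (hH : H.Regular) (π : Measure S) : hH.GapLE π 0 2 := by
  intro u hu μ ν _ _ _ _
  rw [bind_pow_zero, bind_pow_zero]
  have h1 : ∫ z, u z ∂μ ≤ ∫ _, (1 : ℝ) ∂μ := integral_mono (hu.integrable μ) (integrable_const _)
    fun z => (abs_le.1 (hu.abs_le_one z)).2
  have h2 : ∫ _, (-1 : ℝ) ∂ν ≤ ∫ z, u z ∂ν := integral_mono (integrable_const _) (hu.integrable ν)
    fun z => (abs_le.1 (hu.abs_le_one z)).1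
  simp only [integral_const, probReal_univ, smul_eq_mul, one_mul] at h1 h2
  linarith

/-- Two filters started at arbitrary points merge up to the gap and the distances of the laws of the
hidden states from `π`. -/
lemma Regular.GapLE.integral_sub_le {hH : H.Regular} {n : ℕ} {ε : ℝ} (h : hH.GapLE π n ε)
    (hπ : StronglyErgodic H.markovKernel π) {u : AcProb H.lam → ℝ} (hu : IsConeLipschitz u)
    (m : ℕ) (x y : AcProb H.lam) :
    ∫ z, u z ∂((hH.filterKernel ^ (m + n)) x) - ∫ z, u z ∂((hH.filterKernel ^ (m + n)) y) ≤
      ε + tvDist (x.toMeasure.bind ⇑(H.markovKernel ^ m)) π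
        + tvDist (y.toMeasure.bind ⇑(H.markovKernel ^ m)) π := by
  have hv := hH.isConeLipschitz_integral_pow hu n
  have key : ∀ x : AcProb H.lam, ∃ ν : Measure (AcProb H.lam), IsProbabilityMeasure ν ∧
      barycenter H.lam ν = π ∧ |∫ z, u z ∂((hH.filterKernel ^ (m + n)) x) -
        ∫ z, u z ∂(ν.bind ⇑(hH.filterKernel ^ n))| ≤
          tvDist (x.toMeasure.bind ⇑(H.markovKernel ^ m)) π := by
    intro x
    obtain ⟨ν, h1, h2, h3⟩ := exists_barycenter_eq ((hH.filterKernel ^ m) x) hπ.limit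
    refine ⟨ν, h1, h2, ?_⟩
    rw [integral_pow_add _ hu.measurable hu.abs_le_one, hH.integral_bind_pow hu, ← hH.barycenter_pow]
    exact h3 _ hv
  obtain ⟨ν₁, p1, b1, h1⟩ := key x
  obtain ⟨ν₂, p2, b2, h2⟩ := key y
  have h3 := h u hu ν₁ ν₂ p1 p2 b1 b2
  rw [abs_le] at h1 h2
  linarith

/-- One application of Condition E improves the gap from `ε` to a convex combination of `ρ` and `ε`,
up to an error that is an average over `π` of the distance of the hidden chain from its limit. -/
lemma Regular.GapLE.step {hH : H.Regular} {n : ℕ} {ε : ℝ} (h : hH.GapLE π n ε)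
    (hπ : StronglyErgodic H.markovKernel π) {ρ α : ℝ} (hρε : ρ ≤ ε) {N : ℕ}
    (hN : ∀ μ ν : Measure (AcProb H.lam), IsProbabilityMeasure μ → IsProbabilityMeasure ν →
      barycenter H.lam μ = π → barycenter H.lam ν = π →
        ∃ γ : Measure (AcProb H.lam × AcProb H.lam),
          IsCoupling γ (μ.bind ⇑(hH.filterKernel ^ N)) (ν.bind ⇑(hH.filterKernel ^ N)) ∧
            ENNReal.ofReal α ≤ γ {z | dist z.1 z.2 < ρ}) (m : ℕ) :
    hH.GapLE π (N + ((m + 1) + n))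
      (α * ρ + (1 - α) * ε + 4 * ∫ s, tvDist ((H.markovKernel ^ (m + 1)) s) π ∂π) := by
  intro u hu μ ν pμ pν bμ bν
  have := hπ.isProbabilityMeasure
  obtain ⟨γ, hγ, hα⟩ := hN μ ν pμ pν bμ bν
  have := hγ.isProbabilityMeasure
  have hv := hH.isConeLipschitz_integral_pow hu ((m + 1) + n)
  set v : AcProb H.lam → ℝ := fun z => ∫ y, u y ∂((hH.filterKernel ^ ((m + 1) + n)) z) with hvd
  set t : S → ℝ := fun s => tvDist ((H.markovKernel ^ (m + 1)) s) π with htd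
  have htm : Measurable t := hπ.measurable_tvDist m
  have ht0 : ∀ s, 0 ≤ t s := fun s => tvDist_nonneg _ _
  have ht2 : ∀ s, t s ≤ 2 := fun s => tvDist_le_two _ _
  set b : AcProb H.lam → ℝ := fun z => ∫ s, t s ∂z.toMeasure with hbd
  have hbm : Measurable b :=
    (htm.stronglyMeasurable.integral_kernel
      (κ := ⟨AcProb.toMeasure, measurable_toMeasure H.lam⟩)).measurable
  have hb0 : ∀ z, 0 ≤ b z := fun z => integral_nonneg ht0
  have hti : ∀ z : AcProb H.lam, Integrable t z.toMeasure := fun z =>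
    Integrable.of_bound (C := 2) htm.aestronglyMeasurable (Eventually.of_forall fun s => by
      rw [Real.norm_of_nonneg (ht0 s)]; exact ht2 s)
  have hb2 : ∀ z, b z ≤ 2 := fun z => by
    calc b z ≤ ∫ _, (2 : ℝ) ∂z.toMeasure := integral_mono (hti z) (integrable_const _) ht2
      _ = 2 := by simp
  have hbi : ∀ (κ : Measure (AcProb H.lam)) [IsProbabilityMeasure κ], Integrable b κ := fun κ _ =>
    Integrable.of_bound (C := 2) hbm.aestronglyMeasurable (Eventually.of_forall fun z => by
      rw [Real.norm_of_nonneg (hb0 z)]; exact hb2 z)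
  -- the barycenter of the marginals is still `π`
  have hbint : ∀ κ : Measure (AcProb H.lam), IsProbabilityMeasure κ → barycenter H.lam κ = π →
      ∫ z, b z ∂(κ.bind ⇑(hH.filterKernel ^ N)) = ∫ s, t s ∂π := by
    intro κ _ hκ
    have e : barycenter H.lam (κ.bind ⇑(hH.filterKernel ^ N)) = π := by
      rw [hH.barycenter_bind_pow, hκ, hπ.bind_pow_eq]
    have hi : Integrable t (((⟨AcProb.toMeasure, measurable_toMeasure H.lam⟩ :
        Kernel (AcProb H.lam) S).comp
          (Kernel.const Unit (κ.bind ⇑(hH.filterKernel ^ N)))) ()) := by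
      rw [Kernel.comp_apply, Kernel.const_apply]
      change Integrable t (barycenter H.lam (κ.bind ⇑(hH.filterKernel ^ N)))
      rw [e]
      exact Integrable.of_bound (C := 2) htm.aestronglyMeasurable
        (Eventually.of_forall fun s => by
          rw [Real.norm_of_nonneg (ht0 s)]; exact ht2 s)
    have h1 := Kernel.integral_comp hi
    rw [Kernel.comp_apply, Kernel.const_apply] at h1
    refine Eq.trans h1.symm ?_
    change ∫ s, t s ∂(barycenter H.lam (κ.bind ⇑(hH.filterKernel ^ N))) = _
    rw [e]
  have hf1 : Measurable fun z : AcProb H.lam × AcProb H.lam => v z.1 :=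
    hv.measurable.comp measurable_fst
  have hf2 : Measurable fun z : AcProb H.lam × AcProb H.lam => v z.2 :=
    hv.measurable.comp measurable_snd
  have i1 : Integrable (fun z : AcProb H.lam × AcProb H.lam => v z.1) γ :=
    Integrable.of_bound hf1.aestronglyMeasurable 1
      (Eventually.of_forall fun z => hv.abs_le_one z.1)
  have i2 : Integrable (fun z : AcProb H.lam × AcProb H.lam => v z.2) γ :=
    Integrable.of_bound hf2.aestronglyMeasurable 1
      (Eventually.of_forall fun z => hv.abs_le_one z.2)
  have j1 : Integrable (fun z : AcProb H.lam × AcProb H.lam => b z.1) γ :=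
    Integrable.of_bound (C := 2) (hbm.comp measurable_fst).aestronglyMeasurable
      (Eventually.of_forall fun z => by rw [Real.norm_of_nonneg (hb0 _)]; exact hb2 _)
  have j2 : Integrable (fun z : AcProb H.lam × AcProb H.lam => b z.2) γ :=
    Integrable.of_bound (C := 2) (hbm.comp measurable_snd).aestronglyMeasurable
      (Eventually.of_forall fun z => by rw [Real.norm_of_nonneg (hb0 _)]; exact hb2 _)
  have m1 : ∀ f : AcProb H.lam → ℝ, Measurable f →
      ∫ z, f z.1 ∂γ = ∫ z, f z ∂(μ.bind ⇑(hH.filterKernel ^ N)) := fun f hf => by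
    rw [← hγ.map_fst, integral_map measurable_fst.aemeasurable hf.aestronglyMeasurable]
  have m2 : ∀ f : AcProb H.lam → ℝ, Measurable f →
      ∫ z, f z.2 ∂γ = ∫ z, f z ∂(ν.bind ⇑(hH.filterKernel ^ N)) := fun f hf => by
    rw [← hγ.map_snd, integral_map measurable_snd.aemeasurable hf.aestronglyMeasurable]
  have main := integral_le_of_le_on γ (f := fun z => v z.1 - v z.2)
    (e := fun z => 2 * b z.1 + 2 * b z.2) (hf1.sub hf2) (i1.sub i2)
    ((j1.const_mul 2).add (j2.const_mul 2))
    (fun z => by have := hb0 z.1; have := hb0 z.2; positivity) hρε hα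
    (fun z hz => (le_abs_self _).trans ((hv.abs_sub_le_dist z.1 z.2).trans (le_of_lt hz)))
    (fun z => by
      have h1 := h.integral_sub_le hπ hu (m + 1) z.1 z.2
      have h2 := hπ.tvDist_bind_pow_le z.1.toMeasure m
      have h3 := hπ.tvDist_bind_pow_le z.2.toMeasure m
      simp only [hvd, hbd, htd]
      linarith)
  rw [integral_sub i1 i2, integral_add (j1.const_mul 2) (j2.const_mul 2), integral_const_mul,
    integral_const_mul, m1 v hv.measurable, m2 v hv.measurable, m1 b hbm, m2 b hbm,
    hbint μ pμ bμ, hbint ν pν bν] at main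
  rw [hH.integral_bind_pow_add hu, hH.integral_bind_pow_add hu]
  linarith

/-- Under Condition E the gap between initial laws with barycenter `π` vanishes. -/
lemma Regular.exists_gapLE (hH : H.Regular) (hπ : StronglyErgodic H.markovKernel π)
    (hE : hH.ConditionE π) {ε : ℝ} (hε : 0 < ε) : ∃ n, hH.GapLE π n ε := by
  have := hπ.isProbabilityMeasure
  set G : Set ℝ := {ε | 0 ≤ ε ∧ ∃ n, hH.GapLE π n ε} with hG
  have hne : G.Nonempty := ⟨2, by norm_num, 0, hH.gapLE_two π⟩
  have hbdd : BddBelow G := ⟨0, fun e he => he.1⟩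
  have hd0 : 0 ≤ sInf G := le_csInf hne fun e he => he.1
  rcases hd0.lt_or_eq with hd | hd
  · exfalso
    set d := sInf G with hdd
    -- with `ρ = d / 2` one step from a gap just above `d` gives a gap below `d`
    obtain ⟨N, α, hα, hN⟩ := hE (d / 2) (by positivity)
    -- Condition E applied to the point mass at `π` bounds `α` by the mass of a coupling
    have hα1 : α ≤ 1 := by
      have hL : barycenter H.lam (Measure.dirac hπ.limit) = π := barycenter_dirac hπ.limit
      obtain ⟨γ, h1, h2⟩ := hN _ _ Measure.dirac.isProbabilityMeasure
        Measure.dirac.isProbabilityMeasure hL hL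
      have := h1.isProbabilityMeasure
      exact ENNReal.ofReal_le_one.1 (h2.trans prob_le_one)
    obtain ⟨e, ⟨he0, n, hn⟩, he⟩ :=
      exists_lt_of_csInf_lt hne (show sInf G < d + α * d / 8 by rw [← hdd]; linarith [mul_pos hα hd])
    have hde : d ≤ e := csInf_le hbdd ⟨he0, n, hn⟩
    have hev := (hπ.tendsto_integral_tvDist π).eventually_lt_const
      (show (0 : ℝ) < α * d / 16 by positivity)
    obtain ⟨m, hm⟩ := hev.exists
    have hstep := hn.step hπ (show d / 2 ≤ e by linarith) hN m
    set η := ∫ s, tvDist ((H.markovKernel ^ (m + 1)) s) π ∂π with hη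
    have hη0 : 0 ≤ η := integral_nonneg fun s => tvDist_nonneg _ _
    have hnew : 0 ≤ α * (d / 2) + (1 - α) * e + 4 * η := by
      have : 0 ≤ (1 - α) * e := mul_nonneg (by linarith) he0
      positivity
    have hle : d ≤ α * (d / 2) + (1 - α) * e + 4 * η := csInf_le hbdd ⟨hnew, _, hstep⟩
    have h1 : (1 - α) * e ≤ (1 - α) * (d + α * d / 8) :=
      mul_le_mul_of_nonneg_left he.le (by linarith)
    have h2 : 0 < α * d := mul_pos hα hd
    nlinarith [mul_nonneg hα.le h2.le]
  · obtain ⟨e, ⟨-, n, hn⟩, he⟩ := exists_lt_of_csInf_lt hne (hd ▸ hε : sInf G < ε)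
    exact ⟨n, fun u hu μ ν p1 p2 b1 b2 => (hn u hu μ ν p1 p2 b1 b2).trans he.le⟩

/-- Merging of two filters with a bound that depends on the starting points only through the
distance of the laws of the hidden states from `π`. -/
lemma Regular.exists_forall_integral_sub_le (hH : H.Regular)
    (hπ : StronglyErgodic H.markovKernel π) (hE : hH.ConditionE π) {ε : ℝ} (hε : 0 < ε) :
    ∃ n, ∀ u : AcProb H.lam → ℝ, LipschitzWith 1 u → ∀ m (x y : AcProb H.lam),
      ∫ z, u z ∂((hH.filterKernel ^ (m + n)) x) - ∫ z, u z ∂((hH.filterKernel ^ (m + n)) y) ≤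
        ε + 4 * tvDist (x.toMeasure.bind ⇑(H.markovKernel ^ m)) π
          + 4 * tvDist (y.toMeasure.bind ⇑(H.markovKernel ^ m)) π := by
  obtain ⟨n, hn⟩ := hH.exists_gapLE hπ hE (show 0 < ε / 4 by positivity)
  refine ⟨n, fun u hu m x y => ?_⟩
  have hv := isConeLipschitz_of_lipschitz hu x
  have h := hn.integral_sub_le hπ hv m x y
  rw [integral_sub_div_four hu, integral_sub_div_four hu] at h
  linarith

lemma Regular.weaklyContracting (hH : H.Regular) (hπ : StronglyErgodic H.markovKernel π)
    (hE : hH.ConditionE π) : WeaklyContracting hH.filterKernel := by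
  intro x y
  rw [ENNReal.tendsto_atTop_zero]
  intro ε hε
  rcases eq_or_ne ε ∞ with rfl | hε'
  · exact ⟨0, fun _ _ => le_top⟩
  have hε2 : 0 < ε.toReal := ENNReal.toReal_pos hε.ne' hε'
  obtain ⟨n, hn⟩ := hH.exists_forall_integral_sub_le hπ hE (show 0 < ε.toReal / 2 by positivity)
  have h1 := ((hπ.tendsto_tvDist_bind x.toMeasure).eventually_lt_const
    (show (0 : ℝ) < ε.toReal / 16 by positivity)).and
    ((hπ.tendsto_tvDist_bind y.toMeasure).eventually_lt_const
    (show (0 : ℝ) < ε.toReal / 16 by positivity))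
  obtain ⟨M, hM⟩ := eventually_atTop.1 h1
  refine ⟨M + 1 + n, fun k hk => iSup_le fun u => ?_⟩
  obtain ⟨m, rfl, hm⟩ : ∃ m, k = m + 1 + n ∧ M ≤ m := ⟨k - 1 - n, by omega, by omega⟩
  refine ENNReal.ofReal_le_of_le_toReal ?_
  have h2 := hn u.1 u.2 (m + 1) x y
  have h3 := hM m hm
  linarith [h3.1, h3.2]

end DensityHMM

/-! ### Completeness and separability of the space of probabilities -/

section Polish

variable {S : Type*} [MeasurableSpace S] {lam : Measure S}

namespace AcProb

lemma integrable_density (x : AcProb lam) :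
    Integrable (fun s => (x.toMeasure.rnDeriv lam s).toReal) lam :=
  Measure.integrable_toReal_rnDeriv

/-- The density of an absolutely continuous probability, as an element of `L¹`. -/
def density (x : AcProb lam) : Lp ℝ 1 lam := x.integrable_density.toL1 _

lemma coeFn_density (x : AcProb lam) :
    x.density =ᵐ[lam] fun s => (x.toMeasure.rnDeriv lam s).toReal :=
  x.integrable_density.coeFn_toL1

lemma dist_density (x y : AcProb lam) :
    dist x.density y.density = ∫ s, |x.density s - y.density s| ∂lam := by
  rw [dist_eq_norm, L1.norm_eq_integral_norm]
  refine integral_congr_ae ?_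
  filter_upwards [Lp.coeFn_sub x.density y.density] with s hs
  rw [hs, Pi.sub_apply, Real.norm_eq_abs]

variable [SigmaFinite lam]

lemma setIntegral_density (x : AcProb lam) {F : Set S} (hF : MeasurableSet F) :
    ∫ s in F, x.density s ∂lam = x.toMeasure.real F := by
  rw [setIntegral_congr_ae hF (x.coeFn_density.mono fun s hs _ => hs)]
  exact Measure.setIntegral_toReal_rnDeriv x.absolutelyContinuous F

lemma dist_le_two_mul_dist_density (x y : AcProb lam) :
    dist x y ≤ 2 * dist x.density y.density := by
  rw [two_mul, AcProb.dist_def]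
  refine tvDist_le_of_forall _ _ fun F hF => ?_
  have hi := (L1.integrable_coeFn x.density).sub (L1.integrable_coeFn y.density)
  rw [← x.setIntegral_density hF, ← y.setIntegral_density hF,
    ← integral_sub (L1.integrable_coeFn _).integrableOn (L1.integrable_coeFn _).integrableOn, dist_density]
  refine abs_integral_le_integral_abs.trans
    (setIntegral_le_integral hi.abs (Eventually.of_forall fun s => abs_nonneg _))

/-- The set where one density dominates the other attains the suprema that define the distance. -/
lemma dist_density_le_dist (x y : AcProb lam) : dist x.density y.density ≤ dist x y := by
  have hE : MeasurableSet {s | y.density s ≤ x.density s} :=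
    measurableSet_le (Lp.stronglyMeasurable y.density).measurable
      (Lp.stronglyMeasurable x.density).measurable
  have hi : Integrable (fun s => |x.density s - y.density s|) lam :=
    ((L1.integrable_coeFn x.density).sub (L1.integrable_coeFn y.density)).abs
  rw [dist_density, ← integral_add_compl hE hi]
  have e1 : ∫ s in {s | y.density s ≤ x.density s}, |x.density s - y.density s| ∂lam =
      x.toMeasure.real {s | y.density s ≤ x.density s} -
        y.toMeasure.real {s | y.density s ≤ x.density s} := by
    rw [← x.setIntegral_density hE, ← y.setIntegral_density hE,
      ← integral_sub (L1.integrable_coeFn _).integrableOn (L1.integrable_coeFn _).integrableOn]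
    exact setIntegral_congr_fun hE fun s hs => abs_of_nonneg (sub_nonneg.2 hs)
  have e2 : ∫ s in {s | y.density s ≤ x.density s}ᶜ, |x.density s - y.density s| ∂lam =
      y.toMeasure.real {s | y.density s ≤ x.density s}ᶜ -
        x.toMeasure.real {s | y.density s ≤ x.density s}ᶜ := by
    rw [← x.setIntegral_density hE.compl, ← y.setIntegral_density hE.compl,
      ← integral_sub (L1.integrable_coeFn _).integrableOn (L1.integrable_coeFn _).integrableOn]
    refine setIntegral_congr_fun hE.compl fun s hs => ?_
    have hs' : ¬ y.density s ≤ x.density s := hs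
    rw [abs_of_neg (by linarith [not_le.1 hs'])]
    ring
  have := add_le_add (real_sub_le_iSup x.toMeasure y.toMeasure hE)
    (real_sub_le_iSup y.toMeasure x.toMeasure hE.compl)
  rw [AcProb.dist_def]
  exact (add_le_add e1.le e2.le).trans this

lemma isUniformEmbedding_density : IsUniformEmbedding (AcProb.density (lam := lam)) := by
  have h1 : AntilipschitzWith 2 (AcProb.density (lam := lam)) :=
    AntilipschitzWith.of_le_mul_dist fun x y => dist_le_two_mul_dist_density x y
  have h2 : LipschitzWith 1 (AcProb.density (lam := lam)) :=
    LipschitzWith.of_dist_le_mul fun x y => by simpa using dist_density_le_dist x y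
  exact h1.isUniformEmbedding h2.uniformContinuous

/-- The densities form a closed subset of `L¹`. -/
lemma range_density : Set.range (AcProb.density (lam := lam)) =
    {f : Lp ℝ 1 lam | 0 ≤ f ∧ ∫ s, f s ∂lam = 1} := by
  ext f
  constructor
  · rintro ⟨x, rfl⟩
    refine ⟨?_, ?_⟩
    · rw [← Lp.coeFn_nonneg]
      filter_upwards [x.coeFn_density] with s hs
      rw [hs]
      exact ENNReal.toReal_nonneg
    · have := x.setIntegral_density MeasurableSet.univ
      rwa [Measure.restrict_univ, probReal_univ] at this
  · rintro ⟨h0, h1⟩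
    rw [← Lp.coeFn_nonneg] at h0
    have hm : Measurable fun s => ENNReal.ofReal (f s) :=
      (Lp.stronglyMeasurable f).measurable.ennreal_ofReal
    have hp : IsProbabilityMeasure (lam.withDensity fun s => ENNReal.ofReal (f s)) := ⟨by
      rw [withDensity_apply _ .univ, Measure.restrict_univ,
        ← ofReal_integral_eq_lintegral_ofReal (L1.integrable_coeFn f) h0, h1, ENNReal.ofReal_one]⟩
    refine ⟨⟨_, hp, withDensity_absolutelyContinuous _ _⟩, Lp.ext ?_⟩
    refine (coeFn_density _).trans ?_
    filter_upwards [Measure.rnDeriv_withDensity lam hm, h0] with s hs hs0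
    rw [hs, ENNReal.toReal_ofReal hs0]

instance : CompleteSpace (AcProb lam) := by
  rw [completeSpace_iff_isComplete_range isUniformEmbedding_density.isUniformInducing,
    range_density]
  exact ((isClosed_Ici (a := (0 : Lp ℝ 1 lam))).inter
    (isClosed_eq continuous_integral continuous_const)).isComplete

instance [MeasurableSpace.CountablyGenerated S] : SecondCountableTopology (AcProb lam) := by
  have : Fact ((1 : ℝ≥0∞) ≠ ∞) := ⟨ENNReal.one_ne_top⟩
  exact isUniformEmbedding_density.isEmbedding.secondCountableTopology

end AcProb

end Polish

/-! ### Criteria for tightness and weak ergodicity -/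

section Tight

/-- The truncated distance to a set, a bounded `1`-Lipschitz function. -/
lemma lipschitzWith_min_infDist {X : Type*} [MetricSpace X] (C : Set X) (δ : ℝ) :
    LipschitzWith 1 fun x => min (Metric.infDist x C) δ := by
  simpa using (Metric.lipschitz_infDist_pt C).min (LipschitzWith.const' δ (K := 1))

variable {X : Type*} [MetricSpace X] [MeasurableSpace X] [BorelSpace X]

/-- A sequence of probabilities that is Cauchy uniformly over `1`-Lipschitz functions is tight: the
truncated distance to a compact set carrying most of the mass of the first measures shows that the
later ones give most of their mass to a neighborhood of that set. -/
lemma isTightMeasureSet_range_of_cauchy [CompleteSpace X] [SecondCountableTopology X]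
    (μ : ℕ → Measure X) [∀ n, IsProbabilityMeasure (μ n)]
    (h : ∀ ε : ℝ, 0 < ε → ∃ N, ∀ n, N ≤ n → ∀ u : X → ℝ, LipschitzWith 1 u →
      (∃ C, ∀ x, |u x| ≤ C) → ∫ x, u x ∂(μ n) - ∫ x, u x ∂(μ N) ≤ ε) :
    IsTightMeasureSet (Set.range μ) := by
  rw [isTightMeasureSet_iff_exists_isCompact_measure_compl_le]
  intro ε hε
  obtain ⟨η, hη, hsum⟩ := ENNReal.exists_pos_sum_of_countable' hε.ne' ℕ
  have hηtop : ∀ k, η k ≠ ∞ := fun k =>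
    ne_top_of_lt ((ENNReal.le_tsum k).trans_lt (hsum.trans_le le_top))
  have hη0 : ∀ k, 0 < (η k).toReal := fun k => ENNReal.toReal_pos (hη k).ne' (hηtop k)
  obtain ⟨x₀⟩ : Nonempty X := nonempty_of_isProbabilityMeasure (μ 0)
  have key : ∀ k : ℕ, ∃ C : Set X, IsCompact C ∧ C.Nonempty ∧
      ∀ n, μ n {x | Metric.infDist x C ≤ 1 / (k + 1 : ℝ)}ᶜ ≤ η k := by
    intro k
    set δ : ℝ := 1 / (k + 1) with hδ
    have hδ0 : 0 < δ := by positivity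
    obtain ⟨N, hN⟩ := h (δ * ((η k).toReal / 2)) (by have := hη0 k; positivity)
    have ht : ∀ i, ∃ K : Set X, IsCompact K ∧ μ i Kᶜ ≤ η k / 2 := fun i => by
      obtain ⟨K, hK, hK'⟩ := isTightMeasureSet_iff_exists_isCompact_measure_compl_le.1
        (isTightMeasureSet_singleton (μ := μ i)) (η k / 2) (ENNReal.half_pos (hη k).ne')
      exact ⟨K, hK, hK' _ rfl⟩
    choose K hK hKμ using ht
    -- the extra point keeps `C` nonempty; the distance to the empty set would be `0`
    set C : Set X := (⋃ i ∈ Finset.range (N + 1), K i) ∪ {x₀} with hC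
    have hCc : IsCompact C :=
      ((Finset.range (N + 1)).isCompact_biUnion fun i _ => hK i).union isCompact_singleton
    have hCne : C.Nonempty := ⟨x₀, Or.inr rfl⟩
    have hCμ : ∀ i, i ≤ N → μ i Cᶜ ≤ η k / 2 := fun i hi => by
      refine (measure_mono (Set.compl_subset_compl.2 ?_)).trans (hKμ i)
      intro x hx
      exact Or.inl (Set.mem_biUnion (Finset.mem_coe.2 (Finset.mem_range.2 (by omega))) hx)
    refine ⟨C, hCc, hCne, fun n => ?_⟩
    rcases le_total n N with hn | hn
    · exact (measure_mono (Set.compl_subset_compl.2 fun x hx =>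
        (Metric.infDist_zero_of_mem hx).le.trans hδ0.le)).trans
        ((hCμ n hn).trans ENNReal.half_le_self)
    · set u : X → ℝ := fun x => min (Metric.infDist x C) δ with hu
      have hul : LipschitzWith 1 u := lipschitzWith_min_infDist C δ
      have hu0 : ∀ x, 0 ≤ u x := fun x => le_min Metric.infDist_nonneg hδ0.le
      have hub : ∀ x, |u x| ≤ δ := fun x => by
        rw [abs_of_nonneg (hu0 x)]; exact min_le_right _ _
      have hui : ∀ i, Integrable u (μ i) := fun i =>
        Integrable.of_bound hul.continuous.measurable.aestronglyMeasurable δ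
          (Eventually.of_forall hub)
      have h1 : ∫ x, u x ∂(μ N) ≤ δ * ((η k).toReal / 2) := by
        have hm : MeasurableSet Cᶜ := hCc.isClosed.measurableSet.compl
        calc ∫ x, u x ∂(μ N) ≤ ∫ x, Cᶜ.indicator (fun _ => δ) x ∂(μ N) := by
              refine integral_mono (hui N) ((integrable_const δ).indicator hm) fun x => ?_
              by_cases hx : x ∈ C
              · rw [Set.indicator_of_notMem (by simpa using hx)]
                exact (min_le_left _ _).trans_eq (Metric.infDist_zero_of_mem hx)
              · rw [Set.indicator_of_mem (by simpa using hx)]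
                exact min_le_right _ _
          _ = δ * (μ N).real Cᶜ := by
              rw [integral_indicator_const _ hm, smul_eq_mul, mul_comm]
          _ ≤ δ * ((η k).toReal / 2) := by
              refine mul_le_mul_of_nonneg_left ?_ hδ0.le
              have := ENNReal.toReal_mono (ENNReal.div_ne_top (hηtop k) two_ne_zero)
                (hCμ N le_rfl)
              simpa [measureReal_def] using this
      have h2 := hN n hn u hul ⟨δ, hub⟩
      have h3 := mul_meas_ge_le_integral_of_nonneg (Eventually.of_forall hu0) (hui n) δ
      have h4 : (μ n).real {x | δ ≤ u x} ≤ (η k).toReal := by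
        refine le_of_mul_le_mul_left ?_ hδ0
        linarith
      have h5 : μ n {x | δ ≤ u x} ≤ η k :=
        (ENNReal.toReal_le_toReal (measure_ne_top _ _) (hηtop k)).1 h4
      refine (measure_mono fun x hx => ?_).trans h5
      have hx' : ¬ Metric.infDist x C ≤ δ := hx
      exact le_min (not_le.1 hx').le le_rfl
  choose C hC hCne hCμ using key
  refine ⟨⋂ k : ℕ, {x | Metric.infDist x (C k) ≤ 1 / (k + 1 : ℝ)}, ?_, ?_⟩
  · refine TotallyBounded.isCompact_of_isClosed ?_
      (isClosed_iInter fun k => isClosed_le (Metric.continuous_infDist_pt _) continuous_const)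
    rw [Metric.totallyBounded_iff]
    intro r hr
    obtain ⟨k, hk⟩ := exists_nat_one_div_lt (show 0 < r / 2 by positivity)
    obtain ⟨t, -, htf, ht⟩ := (hC k).finite_cover_balls (show 0 < r / 2 by positivity)
    refine ⟨t, htf, fun x hx => ?_⟩
    have hx1 : Metric.infDist x (C k) ≤ 1 / (k + 1 : ℝ) := Set.mem_iInter.1 hx k
    obtain ⟨y, hy, hxy⟩ := (Metric.infDist_lt_iff (hCne k)).1 (hx1.trans_lt hk)
    obtain ⟨z, hz, hyz⟩ := Set.mem_iUnion₂.1 (ht hy)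
    refine Set.mem_iUnion₂.2 ⟨z, hz, ?_⟩
    rw [Metric.mem_ball] at hyz ⊢
    linarith [dist_triangle x y z]
  · rintro _ ⟨n, rfl⟩
    rw [Set.compl_iInter]
    exact (measure_iUnion_le _).trans ((ENNReal.tsum_le_tsum fun k => hCμ k n).trans hsum.le)

end Tight

section Criteria

variable {X : Type*} [MetricSpace X] [MeasurableSpace X] {Q : Kernel X X}

lemma WeaklyContracting.tendsto_sub (h : WeaklyContracting Q) {u : X → ℝ}
    (hu : LipschitzWith 1 u) {C : ℝ} (hC : ∀ x, |u x| ≤ C) (x y : X) :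
    Tendsto (fun n : ℕ => ∫ z, u z ∂(Q ^ n) x - ∫ z, u z ∂(Q ^ n) y) atTop (𝓝 0) := by
  have key : ∀ x y, ∀ ε : ℝ, 0 < ε → ∀ᶠ n : ℕ in atTop,
      ∫ z, u z ∂(Q ^ n) x - ∫ z, u z ∂(Q ^ n) y ≤ ε := by
    intro x y ε hε
    set v : BoundedContinuousFunction X ℝ :=
      BoundedContinuousFunction.ofNormedAddCommGroup u hu.continuous C hC with hv
    filter_upwards [(ENNReal.tendsto_nhds_zero.1 (h x y)) (ENNReal.ofReal ε)
      (ENNReal.ofReal_pos.2 hε)] with n hn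
    have h1 := (le_iSup (fun u : {u : BoundedContinuousFunction X ℝ // LipschitzWith 1 u} =>
      ENNReal.ofReal ((∫ z, u.1 z ∂(Q ^ n) x) - ∫ z, u.1 z ∂(Q ^ n) y)) ⟨v, hu⟩).trans hn
    exact (ENNReal.ofReal_le_ofReal_iff hε.le).1 h1
  rw [Metric.tendsto_nhds]
  intro ε hε
  filter_upwards [key x y (ε / 2) (by positivity), key y x (ε / 2) (by positivity)] with n h1 h2
  rw [Real.dist_eq, sub_zero, abs_lt]
  constructor <;> linarith

variable [BorelSpace X] [IsMarkovKernel Q]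

/-- A weakly contracting kernel is weakly ergodic as soon as one orbit converges when tested
against bounded `1`-Lipschitz functions. -/
lemma WeaklyContracting.weaklyErgodic_of_tendsto (h : WeaklyContracting Q) (x₀ : X) (ν : Measure X)
    [IsProbabilityMeasure ν]
    (hν : ∀ u : X → ℝ, LipschitzWith 1 u → ∀ C : ℝ, (∀ x, |u x| ≤ C) →
      Tendsto (fun n : ℕ => ∫ z, u z ∂(Q ^ n) x₀) atTop (𝓝 (∫ z, u z ∂ν))) :
    WeaklyErgodic Q := by
  refine ⟨h, ν, inferInstance, fun u x => ?_⟩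
  set P : ℕ → ProbabilityMeasure X := fun n => ⟨(Q ^ n) x, inferInstance⟩ with hP
  set R : ProbabilityMeasure X := ⟨ν, inferInstance⟩ with hR
  have h1 : Tendsto P atTop (𝓝 R) := by
    rw [tendsto_iff_forall_lipschitz_integral_tendsto]
    rintro f ⟨C, hC⟩ ⟨L, hL⟩
    change Tendsto (fun n : ℕ => ∫ z, f z ∂(Q ^ n) x) atTop (𝓝 (∫ z, f z ∂ν))
    have hL0 : (0 : ℝ) < L + 1 := by positivity
    have hg : LipschitzWith 1 fun z => (L + 1 : ℝ)⁻¹ * f z := by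
      refine LipschitzWith.of_dist_le_mul fun a b => ?_
      have h2 := hL.dist_le_mul a b
      rw [Real.dist_eq] at h2 ⊢
      rw [← mul_sub, abs_mul, abs_of_pos (inv_pos.2 hL0), inv_mul_le_iff₀ hL0, NNReal.coe_one,
        one_mul]
      nlinarith [dist_nonneg (x := a) (y := b)]
    have hb : ∀ z, |(L + 1 : ℝ)⁻¹ * f z| ≤ (L + 1 : ℝ)⁻¹ * (C + |f x₀|) := fun z => by
      have h2 := hC z x₀
      rw [Real.dist_eq] at h2
      have h3 := abs_add_le (f z - f x₀) (f x₀)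
      rw [sub_add_cancel] at h3
      rw [abs_mul, abs_of_pos (inv_pos.2 hL0)]
      gcongr
      linarith
    have h2 := ((h.tendsto_sub hg hb x x₀).add (hν _ hg _ hb)).const_mul (L + 1 : ℝ)
    simp only [sub_add_cancel, zero_add, integral_const_mul] at h2
    simpa only [mul_inv_cancel_left₀ hL0.ne'] using h2
  exact (ProbabilityMeasure.tendsto_iff_forall_integral_tendsto.1 h1) u

lemma WeaklyContracting.weaklyErgodic_of_invariant (h : WeaklyContracting Q) (μ : Measure X)
    [IsProbabilityMeasure μ] (hμ : Kernel.Invariant Q μ) : WeaklyErgodic Q := by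
  obtain ⟨x₀⟩ : Nonempty X := nonempty_of_isProbabilityMeasure μ
  refine h.weaklyErgodic_of_tendsto x₀ μ fun u hu C hC => ?_
  have hμn : ∀ n : ℕ, μ.bind ⇑(Q ^ n) = μ := fun n => by
    induction n with
    | zero => exact bind_pow_zero μ Q
    | succ n ih => rw [bind_pow_succ, ih]; exact hμ
  have hum : Measurable u := hu.continuous.measurable
  have hTm : ∀ n : ℕ, Measurable fun y => ∫ z, u z ∂(Q ^ n) y := fun n =>
    (hum.stronglyMeasurable.integral_kernel).measurable
  have hTb : ∀ (n : ℕ) y, |∫ z, u z ∂(Q ^ n) y| ≤ C := fun n y =>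
    abs_integral_kernel_le hC (Q ^ n) y
  have e : ∀ n : ℕ, ∫ y, (∫ z, u z ∂(Q ^ n) x₀ - ∫ z, u z ∂(Q ^ n) y) ∂μ =
      ∫ z, u z ∂(Q ^ n) x₀ - ∫ z, u z ∂μ := fun n => by
    rw [integral_sub (integrable_const _) (Integrable.of_bound (hTm n).aestronglyMeasurable C
      (Eventually.of_forall (hTb n))), ← integral_bind_kernel μ (Q ^ n) hum hC, hμn n]
    simp
  have h1 : Tendsto (fun n : ℕ => ∫ y, (∫ z, u z ∂(Q ^ n) x₀ - ∫ z, u z ∂(Q ^ n) y) ∂μ) atTop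
      (𝓝 (∫ _, (0 : ℝ) ∂μ)) := by
    refine tendsto_integral_of_dominated_convergence (fun _ => C + C)
      (fun n => (measurable_const.sub (hTm n)).aestronglyMeasurable) (integrable_const _)
      (fun n => Eventually.of_forall fun y => ?_)
      (Eventually.of_forall fun y => h.tendsto_sub hu hC x₀ y)
    exact (abs_sub _ _).trans (add_le_add (hTb n x₀) (hTb n y))
  simp only [e, integral_zero] at h1
  simpa using h1.add_const (∫ z, u z ∂μ)

/-- A tight orbit that is Cauchy when tested against bounded `1`-Lipschitz functions converges, by
Prokhorov's theorem. -/
lemma WeaklyContracting.weaklyErgodic_of_tight (h : WeaklyContracting Q) (x₀ : X)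
    (ht : IsTightMeasureSet {μ : Measure X | ∃ n : ℕ, 1 ≤ n ∧ μ = (Q ^ n) x₀})
    (hc : ∀ u : X → ℝ, LipschitzWith 1 u → ∀ C : ℝ, (∀ x, |u x| ≤ C) →
      CauchySeq fun n : ℕ => ∫ z, u z ∂(Q ^ n) x₀) : WeaklyErgodic Q := by
  set P : ℕ → ProbabilityMeasure X := fun n => ⟨(Q ^ (n + 1)) x₀, inferInstance⟩ with hP
  have hcpt : IsCompact (closure (Set.range P)) := by
    refine isCompact_closure_of_isTightMeasureSet (ht.subset ?_)
    rintro _ ⟨_, ⟨n, rfl⟩, rfl⟩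
    exact ⟨n + 1, by omega, rfl⟩
  obtain ⟨ν, -, hν⟩ := hcpt.exists_mapClusterPt (f := atTop) (u := P)
    (le_principal_iff.2 (mem_map.2 (Eventually.of_forall fun n => subset_closure ⟨n, rfl⟩)))
  refine h.weaklyErgodic_of_tendsto x₀ ν fun u hu C hC => ?_
  rw [← tendsto_add_atTop_iff_nat 1]
  have hcont : Continuous fun μ : ProbabilityMeasure X => ∫ z, u z ∂(μ : Measure X) :=
    ProbabilityMeasure.continuous_integral_boundedContinuousFunction
      (f := BoundedContinuousFunction.ofNormedAddCommGroup u hu.continuous C hC)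
  have h1 : MapClusterPt (∫ z, u z ∂(ν : Measure X)) atTop
      (fun n : ℕ => ∫ z, u z ∂(Q ^ (n + 1)) x₀) := hν.continuousAt_comp hcont.continuousAt
  have h2 : CauchySeq fun n : ℕ => ∫ z, u z ∂(Q ^ (n + 1)) x₀ :=
    (hc u hu C hC).comp_tendsto (tendsto_add_atTop_nat 1)
  exact le_nhds_of_cauchy_adhp h2 h1

end Criteria

/-! ### Weak ergodicity of the filter kernel -/

section Orbit

variable {X : Type*} [MeasurableSpace X] {Q : Kernel X X} [IsMarkovKernel Q]

/-- Two points of an orbit compare like an average of pairs of points at the earlier time. -/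
lemma integral_pow_add_sub (x₀ : X) {u : X → ℝ} (hu : Measurable u) {C : ℝ} (hC : ∀ x, |u x| ≤ C)
    (k n : ℕ) : ∫ z, u z ∂(Q ^ (k + n)) x₀ - ∫ z, u z ∂(Q ^ n) x₀ =
      ∫ y, (∫ z, u z ∂(Q ^ n) y - ∫ z, u z ∂(Q ^ n) x₀) ∂(Q ^ k) x₀ := by
  have hm : Measurable fun y => ∫ z, u z ∂(Q ^ n) y :=
    (hu.stronglyMeasurable.integral_kernel).measurable
  rw [integral_pow_add Q hu hC, integral_sub (Integrable.of_bound hm.aestronglyMeasurable C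
    (Eventually.of_forall fun y => abs_integral_kernel_le hC (Q ^ n) y)) (integrable_const _)]
  simp

lemma integrable_integral_pow_sub (μ : Measure X) [IsProbabilityMeasure μ] {u : X → ℝ}
    (hu : Measurable u) {C : ℝ} (hC : ∀ x, |u x| ≤ C) (n : ℕ) (x₀ : X) :
    Integrable (fun y => ∫ z, u z ∂(Q ^ n) y - ∫ z, u z ∂(Q ^ n) x₀) μ :=
  (Integrable.of_bound ((hu.stronglyMeasurable.integral_kernel).measurable).aestronglyMeasurable C
    (Eventually.of_forall fun y => abs_integral_kernel_le hC (Q ^ n) y)).sub (integrable_const _)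

end Orbit

namespace DensityHMM

variable {S A : Type*} [MeasurableSpace S] [MeasurableSpace A] {H : DensityHMM S A}
  [TopologicalSpace A] [PolishSpace A] [BorelSpace A] {π : Measure S}

lemma Regular.abs_integral_pow_sub_le (hH : H.Regular) {u : AcProb H.lam → ℝ}
    (hu : LipschitzWith 1 u) (n : ℕ) (x y : AcProb H.lam) :
    |∫ z, u z ∂(hH.filterKernel ^ n) x - ∫ z, u z ∂(hH.filterKernel ^ n) y| ≤ 4 * dist x y := by
  have h := (hH.isConeLipschitz_integral_pow (isConeLipschitz_of_lipschitz hu x) n).abs_sub_le_dist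
    x y
  rw [integral_sub_div_four hu, integral_sub_div_four hu] at h
  rw [abs_le] at *
  constructor <;> linarith

/-- Equicontinuity makes the merging of filters uniform on compact sets; along a tight orbit the
integrals of test functions therefore form Cauchy sequences. -/
lemma Regular.cauchySeq_integral_of_tight (hH : H.Regular)
    (hW : WeaklyContracting hH.filterKernel) (x₀ : AcProb H.lam)
    (ht : IsTightMeasureSet {μ : Measure (AcProb H.lam) |
      ∃ n : ℕ, 1 ≤ n ∧ μ = (hH.filterKernel ^ n) x₀})
    {u : AcProb H.lam → ℝ} (hu : LipschitzWith 1 u) {C : ℝ} (hC : ∀ x, |u x| ≤ C) :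
    CauchySeq fun n : ℕ => ∫ z, u z ∂(hH.filterKernel ^ n) x₀ := by
  have hum := hu.continuous.measurable
  have hC0 : 0 ≤ C := (abs_nonneg _).trans (hC x₀)
  rw [Metric.cauchySeq_iff']
  intro ε hε
  -- mass `δ` outside a compact set contributes at most `2Cδ ≤ ε / 4`
  set δ : ℝ := min 1 (ε / (8 * (C + 1))) with hδ
  have hδ0 : 0 < δ := by positivity
  have hδ1 : δ ≤ 1 := min_le_left _ _
  have hδε : δ * (2 * C) ≤ ε / 4 := by
    calc δ * (2 * C) ≤ ε / (8 * (C + 1)) * (2 * C) := by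
          gcongr
          exact min_le_right _ _
      _ ≤ ε / 4 := by
          rw [div_mul_eq_mul_div, div_le_div_iff₀ (by positivity) (by norm_num)]
          nlinarith
  obtain ⟨K, hK, hKμ⟩ := isTightMeasureSet_iff_exists_isCompact_measure_compl_le.1 ht
    (ENNReal.ofReal δ) (ENNReal.ofReal_pos.2 hδ0)
  obtain ⟨t, -, htf, htK⟩ := hK.finite_cover_balls (show 0 < ε / 32 by positivity)
  have hev : ∀ᶠ n : ℕ in atTop, ∀ c ∈ t,
      |∫ z, u z ∂(hH.filterKernel ^ n) c - ∫ z, u z ∂(hH.filterKernel ^ n) x₀| < ε / 8 := by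
    rw [eventually_all_finite htf]
    intro c _
    have h1 := (hW.tendsto_sub hu hC c x₀).abs
    rw [abs_zero] at h1
    exact h1.eventually_lt_const (by positivity)
  obtain ⟨N, hN⟩ := hev.exists
  have hNK : ∀ y ∈ K, |∫ z, u z ∂(hH.filterKernel ^ N) y -
      ∫ z, u z ∂(hH.filterKernel ^ N) x₀| ≤ ε / 4 := by
    intro y hy
    obtain ⟨c, hc, hyc⟩ := Set.mem_iUnion₂.1 (htK hy)
    have h1 := hN c hc
    have h2 := hH.abs_integral_pow_sub_le hu N y c
    rw [Metric.mem_ball] at hyc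
    rw [abs_lt] at h1
    rw [abs_le] at *
    constructor <;> linarith
  refine ⟨N, fun n hn => ?_⟩
  obtain ⟨k, rfl⟩ : ∃ k, n = k + N := ⟨n - N, by omega⟩
  rw [Real.dist_eq]
  rcases Nat.eq_zero_or_pos k with rfl | hk
  · simpa using hε
  have hB : ENNReal.ofReal (1 - δ) ≤ ((hH.filterKernel ^ k) x₀) K := by
    have h1 := hKμ _ ⟨k, hk, rfl⟩
    rw [prob_compl_eq_one_sub hK.isClosed.measurableSet] at h1
    rw [ENNReal.ofReal_sub _ hδ0.le, ENNReal.ofReal_one]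
    exact tsub_le_iff_tsub_le.1 h1
  have hi := integrable_integral_pow_sub (Q := hH.filterKernel) ((hH.filterKernel ^ k) x₀)
    hum hC N x₀
  have hm : Measurable fun y => ∫ z, u z ∂(hH.filterKernel ^ N) y -
      ∫ z, u z ∂(hH.filterKernel ^ N) x₀ :=
    ((hum.stronglyMeasurable.integral_kernel).measurable).sub_const _
  have hall : ∀ y, |∫ z, u z ∂(hH.filterKernel ^ N) y -
      ∫ z, u z ∂(hH.filterKernel ^ N) x₀| ≤ ε / 4 + 2 * C := fun y => by
    refine (abs_sub _ _).trans ?_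
    linarith [abs_integral_kernel_le hC (hH.filterKernel ^ N) y,
      abs_integral_kernel_le hC (hH.filterKernel ^ N) x₀]
  have main := integral_le_of_le_on ((hH.filterKernel ^ k) x₀) (e := fun _ => 0) hm.norm hi.norm
    (integrable_const _) (fun _ => le_rfl) (show ε / 4 ≤ ε / 4 + 2 * C by linarith) hB hNK
    (fun y => by simpa using hall y)
  rw [integral_pow_add_sub x₀ hum hC]
  refine abs_integral_le_integral_abs.trans_lt ?_
  simp only [Real.norm_eq_abs, integral_zero, add_zero] at main
  nlinarith

/-- Under uniform ergodicity the merging of filters is uniform in the starting points. -/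
lemma Regular.exists_forall_integral_sub_le_of_uniformlyErgodic (hH : H.Regular)
    (hE : hH.ConditionE π) (hU : UniformlyErgodic H.markovKernel π) {ε : ℝ} (hε : 0 < ε) :
    ∃ N, ∀ u : AcProb H.lam → ℝ, LipschitzWith 1 u → ∀ x y : AcProb H.lam,
      ∫ z, u z ∂(hH.filterKernel ^ N) x - ∫ z, u z ∂(hH.filterKernel ^ N) y ≤ ε := by
  have hπ := hU.toStronglyErgodic
  have := hπ.isProbabilityMeasure
  obtain ⟨n, hn⟩ := hH.exists_forall_integral_sub_le hπ hE (show 0 < ε / 2 by positivity)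
  obtain ⟨m, hm⟩ := ((hU.tendsto_iSup.comp (tendsto_add_atTop_nat 1)).eventually_lt_const
    (show (0 : ℝ) < ε / 32 by positivity)).exists
  have hb : ∀ x : AcProb H.lam,
      tvDist (x.toMeasure.bind ⇑(H.markovKernel ^ (m + 1))) π ≤ ε / 16 := by
    intro x
    have hbdd : BddAbove (Set.range fun s => tvDist ((H.markovKernel ^ (m + 1)) s) π) :=
      ⟨2, by rintro _ ⟨s, rfl⟩; exact tvDist_le_two _ _⟩
    have hi : Integrable (fun s => tvDist ((H.markovKernel ^ (m + 1)) s) π) x.toMeasure :=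
      Integrable.of_bound (C := 2) (hπ.measurable_tvDist m).aestronglyMeasurable
        (Eventually.of_forall fun s => by
          rw [Real.norm_of_nonneg (tvDist_nonneg _ _)]; exact tvDist_le_two _ _)
    have h1 : ∫ s, tvDist ((H.markovKernel ^ (m + 1)) s) π ∂x.toMeasure ≤
        ∫ _, ε / 32 ∂x.toMeasure :=
      integral_mono hi (integrable_const _) fun s => (le_ciSup hbdd s).trans hm.le
    have h2 := hπ.tvDist_bind_pow_le x.toMeasure m
    simp only [integral_const, probReal_univ, one_smul] at h1
    linarith
  refine ⟨m + 1 + n, fun u hu x y => ?_⟩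
  linarith [hn u hu (m + 1) x y, hb x, hb y]

/-- The orbit of `π` is Cauchy uniformly over test functions, hence tight and convergent. -/
lemma Regular.weaklyErgodic_of_uniformlyErgodic [MeasurableSpace.CountablyGenerated S]
    (hH : H.Regular) (hE : hH.ConditionE π) (hU : UniformlyErgodic H.markovKernel π) :
    WeaklyErgodic hH.filterKernel := by
  have hπ := hU.toStronglyErgodic
  set x₀ : AcProb H.lam := hπ.limit
  have key : ∀ ε : ℝ, 0 < ε → ∃ N, ∀ n, N ≤ n → ∀ u : AcProb H.lam → ℝ, LipschitzWith 1 u →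
      (∃ C, ∀ x, |u x| ≤ C) →
        ∫ z, u z ∂(hH.filterKernel ^ n) x₀ - ∫ z, u z ∂(hH.filterKernel ^ N) x₀ ≤ ε := by
    intro ε hε
    obtain ⟨N, hN⟩ := hH.exists_forall_integral_sub_le_of_uniformlyErgodic hE hU hε
    refine ⟨N, fun n hn u hu ⟨C, hC⟩ => ?_⟩
    obtain ⟨k, rfl⟩ : ∃ k, n = k + N := ⟨n - N, by omega⟩
    rw [integral_pow_add_sub x₀ hu.continuous.measurable hC]
    calc _ ≤ ∫ _, ε ∂(hH.filterKernel ^ k) x₀ :=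
          integral_mono (integrable_integral_pow_sub _ hu.continuous.measurable hC N x₀)
            (integrable_const _) fun y => hN u hu y x₀
      _ = ε := by simp
  have ht : IsTightMeasureSet (Set.range fun n : ℕ => (hH.filterKernel ^ n) x₀) :=
    isTightMeasureSet_range_of_cauchy _ key
  refine (hH.weaklyContracting hπ hE).weaklyErgodic_of_tight x₀ (ht.subset ?_) ?_
  · rintro _ ⟨n, -, rfl⟩
    exact ⟨n, rfl⟩
  · intro u hu C hC
    rw [Metric.cauchySeq_iff']
    intro ε hε
    obtain ⟨N, hN⟩ := key (ε / 2) (by positivity)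
    refine ⟨N, fun n hn => ?_⟩
    have h1 := hN n hn u hu ⟨C, hC⟩
    have h2 := hN n hn (fun x => -u x) hu.neg ⟨C, fun x => by rw [abs_neg]; exact hC x⟩
    simp only [integral_neg] at h2
    rw [Real.dist_eq, abs_lt]
    constructor <;> linarith

end DensityHMM

end

end HMMFilter

theorem theorem4p1 {S A : Type*}
    [TopologicalSpace S] [PolishSpace S] [MeasurableSpace S] [BorelSpace S]
    [TopologicalSpace A] [PolishSpace A] [MeasurableSpace A] [BorelSpace A]
    (H : HMMFilter.DensityHMM S A) (hH : H.Regular) (π : Measure S)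
    (hπ : HMMFilter.StronglyErgodic H.markovKernel π)
    (hE : hH.ConditionE π) :
    HMMFilter.WeaklyContracting hH.filterKernel ∧
      ((∃ μ : Measure (HMMFilter.AcProb H.lam),
          IsProbabilityMeasure μ ∧ Kernel.Invariant hH.filterKernel μ) ∨
        (∃ x₀ : HMMFilter.AcProb H.lam,
          IsTightMeasureSet {μ : Measure (HMMFilter.AcProb H.lam) |
            ∃ n : ℕ, 1 ≤ n ∧ μ = (hH.filterKernel ^ n) x₀}) ∨
        HMMFilter.UniformlyErgodic H.markovKernel π →
        HMMFilter.WeaklyErgodic hH.filterKernel) := by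
  have hW := hH.weaklyContracting hπ hE
  refine ⟨hW, ?_⟩
  rintro (⟨μ, hμ, hinv⟩ | ⟨x₀, ht⟩ | hU)
  · exact hW.weaklyErgodic_of_invariant μ hinv
  · exact hW.weaklyErgodic_of_tight x₀ ht fun u hu C hC =>
      hH.cauchySeq_integral_of_tight hW x₀ ht hu hC
  · exact hH.weaklyErgodic_of_uniformlyErgodic hE hU
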